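/- **Setting.** Let $\mathcal X$ be a finite set, $T>0$, and let $X$ be a continuous-time Markov chain on $\mathcal X$ with right-continuous piecewise constant paths, transition function $Q_{t,r}(y|x)=P(X_r=y\mid X_t=x)$, $0\le t\le r\le T$, continuous in $r\in[t,T]$, and transition rates $G_t(y|x)=\lim_{\tau\downarrow0}\tau^{-1}[Q_{t,t+\tau}(y|x)-\delta_x(y)]$ that exist and are uniformly bounded for $0\le t<T$. Let $P_t^x$ be the law of the chain on $[t,T]$ started at time $t$ in $x$. Histories $\xi_{[0,t]}$ are right-continuous piecewise constant functions $[0,t]\to\mathcal X$ (with any initial state); $\mathcal Z_{t}$ is the space of bounded functionals of the path on $[0,t]$ that are measurable with respect to the $\sigma$-algebra generated by the finite-dimensional cylinders. A dynamic risk measure is a family of maps $\varrho_{t,T}:\mathcal Z_T\to\mathcal Z_t$, $t\in[0,T]$. For $Z\in\mathcal Z_T$, $\varrho_{r,T}(Z)\,|\,\xi_{[0,t]}$ denotes $\varrho_{r,T}(Z)$ as a function of the path on $[t,r]$, with $\xi_{[0,t]}$ fixed. Suppose that $\varrho$ is * *strongly stochastically conditionally time-consistent*: for all $t\in[0,T]$,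 $r_1,r_2\in[t,T]$, all $\xi_{[0,t]}$ and $Z,W\in\mathcal Z_T$, if $P_t^{\xi_t}\{\eta<\varrho_{r_1,T}(Z)|\xi_{[0,t]}\}\le P_t^{\xi_t}\{\eta<\varrho_{r_2,T}(W)|\xi_{[0,t]}\}$ for all $\eta\in\mathbb R$, then $\varrho_{t,T}(Z)(\xi_{[0,t]})\le\varrho_{t,T}(W)(\xi_{[0,t]})$; * *coherent*: each $\varrho_{t,T}$ is monotonic, convex, positively homogeneous, and satisfies $\varrho_{t,T}(Y+Z)=Y+\varrho_{t,T}(Z)$ for $Z\in\mathcal Z_T$, $Y\in\mathcal Z_t$; * *Markovian*: for all $t\in[0,T]$, $c\in L_\infty([t,T]\times\mathcal X)$ and $f:\mathcal X\to\mathbb R$, the value of $\varrho_{t,T}\big(\int_t^Tc_\tau(X_\tau)\,d\tau+f(X_T)\big)$ at a history $\xi_{[0,t]}$ depends only on $\xi_t$. This value, at $\xi_t=x$, is denoted by $v_t(x)=v_t^{c,f}(x)$ (*risk value function*); * *Lipschitz in $L_p$*: there are $p\in[1,\infty)$ and $L$ such that $|\varrho_{t,T}(Y)(\xi_{[0,t]})-\varrho_{t,T}(Y')(\xi_{[0,t]})|\le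 L\,\|Y-Y'\|_{L_p(P_t^{\xi_t})}$ for all $0\le t\le r\le T$, all $\xi_{[0,t]}$, and all bounded measurable functionals $Y,Y'$ of the path on $[t,r]$. Let $\mathcal P(\mathcal X)$ be the set of probability vectors on $\mathcal X$, and let $\sigma_t:\mathcal X\times\mathcal P(\mathcal X)\times\mathbb R^{\mathcal X}\to\mathbb R$, $t\in[0,T]$, be *transition risk mappings* of $\varrho$, that is, $\sigma_t\big(\xi_t,Q_{t,r}(\cdot|\xi_t),v_r\big)=\varrho_{t,T}\big(v_r(X_r)\big)(\xi_{[0,t]})$ for all $0\le t\le r\le T$, all $\xi_{[0,t]}$, and all risk value functions $v=v^{c,f}$ with $c\in L_\infty([0,T]\times\mathcal X)$, $f:\mathcal X\to\mathbb R$. Suppose that $\sigma_t(x,m,\cdot)$ is coherent for all $t\in[0,T]$, $x\in\mathcal X$, $m\in\mathcal P(\mathcal X)$. Put $\mathcal A_t(x,m)=\{\mu\in\mathcal P(\mathcal X):\sum_yv(y)\mu(y)\le\sigma_t(x,m,v)\ \forall v\}$. Let $\mathcal Q$ be the set of stochastic kernels on $\mathcal X$, $I$ the identity kernel, and define the *risk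 multikernel* by $\mathfrak M_t(Q)=\{M\in\mathcal Q: M(x)\in\mathcal A_t(x,Q(x))\ \forall x\}$. Equip the space of signed kernels with the norm $\|K\|=\max_x\sum_y|K(y|x)|$. Suppose that, for every $t\in[0,T)$, $\mathfrak M_t$ is *semi-differentiable* at $I$ in the direction $G_t$: there is a nonempty set $\mathfrak D_t$ of signed kernels such that, for all sequences $0<\varepsilon_n\to0$ and $K_n\to G_t$ with $K_n$ in the tangent cone to $\mathcal Q$ at $I$, the sets $\varepsilon_n^{-1}[\mathfrak M_t(I+\varepsilon_nK_n)-I]$ converge to $\mathfrak D_t$ in the Pompeiu–Hausdorff distance. Let $\mathfrak G_t(x)=\{D(x):D\in\mathfrak D_t\}$ (*risk multigenerator*). Suppose that the multifunctions $t\mapsto\mathfrak G_t(x)$ are measurable and that the sets $\mathfrak G_t(x)$ are uniformly bounded over $t\in[0,T)$, $x\in\mathcal X$. Write $s_{\mathfrak G_t(x)}(w)=\sup_{\lambda\in\mathfrak G_t(x)}\sum_y\lambda(y)w(y)$. **Theorem 8.3.** For all $c\in L_\infty([0,T]\times\mathcal X)$ and $f:\mathcal X\to\mathbb R$, the risk value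 function $v$ is the unique solution on $[0,T]$ of the backward system $$\frac{dv_t(x)}{dt}=-c_t(x)-s_{\mathfrak G_t(x)}(v_t),\qquad v_T(x)=f(x),\qquad x\in\mathcal X,$$ where a solution is a function that is absolutely continuous in $t$, satisfies the differential equation for almost all $t\in[0,T]$, and satisfies the terminal condition. Moreover, for all $x\in\mathcal X$ and every $t\in[0,T)$ with $\lim_{r\downarrow t}\frac1{r-t}\int_t^rc_\tau(x)\,d\tau=c_t(x)$ (hence for every $t\in[0,T)$ if $c$ is right-continuous in time), the right derivative of $v_{\cdot}(x)$ at $t$ exists and equals $-c_t(x)-s_{\mathfrak G_t(x)}(v_t)$. -/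

import Mathlib

open MeasureTheory Filter Topology Set

namespace CTMCRisk

/-! ### Path space -/

/-- Right-continuous piecewise constant trajectories with finitely many jumps: `F` contains the jump
times, and the trajectory does not change on `[s, u]` if there is no jump time in `(s, u]`.
Trajectories are indexed by all real times for convenience; everything below looks at them
only through the sigma-algebras `hist a b` with `0 ≤ a ≤ b ≤ T`, that is, only at their restrictions
to `[a, b]`. -/
def Traj (X : Type*) : Type _ :=
  {ω : ℝ → X // ∃ F : Finset ℝ, ∀ s u : ℝ, s ≤ u → (∀ a ∈ F, ¬ (s < a ∧ a ≤ u)) → ω s = ω u}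

instance {X : Type*} : CoeFun (Traj X) (fun _ => ℝ → X) := ⟨Subtype.val⟩

/-- The sigma-algebra generated by the finite-dimensional cylinders. -/
instance {X : Type*} : MeasurableSpace (Traj X) :=
  ⨆ s : ℝ, MeasurableSpace.comap (fun ω : Traj X => ω s) ⊤

/-- The sigma-algebra generated by the states at the times in `[a, b]`;
`hist 0 t` is the filtration of the process. -/
abbrev hist {X : Type*} (a b : ℝ) : MeasurableSpace (Traj X) :=
  ⨆ s ∈ Icc a b, MeasurableSpace.comap (fun ω : Traj X => ω s) ⊤

/-- The trajectory that stays at `x`. -/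
def Traj.const {X : Type*} (x : X) : Traj X := ⟨fun _ => x, ∅, fun _ _ _ _ => rfl⟩

/-- The trajectory that follows `ξ` before time `t` and `ω` from time `t` on. -/
noncomputable def Traj.glue {X : Type*} (t : ℝ) (ξ ω : Traj X) : Traj X :=
  ⟨fun s => if s < t then ξ s else ω s, by
    classical
    obtain ⟨F, hF⟩ := ξ.2
    obtain ⟨F', hF'⟩ := ω.2
    refine ⟨insert t (F ∪ F'), fun s u hsu h => ?_⟩
    by_cases hu : u < t
    · have hs : s < t := lt_of_le_of_lt hsu hu
      simp only [hu, hs, if_true]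
      exact hF s u hsu fun a ha => h a (by simp [ha])
    · by_cases hs : s < t
      · exact absurd ⟨hs, not_lt.mp hu⟩ (h t (by simp))
      · simp only [hu, hs, if_false]
        exact hF' s u hsu fun a ha => h a (by simp [ha])⟩

/-- The space of bounded functionals of the path on `[a, b]`. -/
def BddFunctional {X : Type*} (a b : ℝ) : Set (Traj X → ℝ) :=
  {Z | Measurable[hist a b] Z ∧ ∃ C : ℝ, ∀ ω, |Z ω| ≤ C}

/-! ### The Markov chain -/

/-- A (time-inhomogeneous) continuous-time Markov chain on the finite state space `X` with
horizon `T`. `Q t r x y` is the probability of being in `y` at time `r` after being in `x` at time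
`t`; `G t x y` is the transition rate from `x` to `y`; `law t x` is the distribution of the chain that
is in `x` at time `t`. Of `law t x` only the restriction to `hist t T` matters; it
is determined by the finite-dimensional distributions `law_fdd`. -/
structure Chain (X : Type*) [Fintype X] [DecidableEq X] (T : ℝ) where
  Q : ℝ → ℝ → X → X → ℝ
  G : ℝ → X → X → ℝ
  law : ℝ → X → Measure (Traj X)
  Q_mem : ∀ t r : ℝ, 0 ≤ t → t ≤ r → r ≤ T → ∀ x, Q t r x ∈ stdSimplex ℝ X
  law_prob : ∀ t ∈ Icc 0 T, ∀ x, IsProbabilityMeasure (law t x)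
  law_fdd : ∀ t ∈ Icc 0 T, ∀ (x : X) (n : ℕ) (s : ℕ → ℝ) (y : ℕ → X),
    s 0 = t → (∀ i < n, s i ≤ s (i + 1)) → s n ≤ T → y 0 = x →
      law t x {ω | ∀ i ≤ n, ω (s i) = y i} =
        ENNReal.ofReal (∏ i ∈ Finset.range n, Q (s i) (s (i + 1)) (y i) (y (i + 1)))
  /-- There are no fixed times of discontinuity. -/
  Q_cont : ∀ t ∈ Icc 0 T, ∀ x y, ContinuousOn (fun r => Q t r x y) (Icc t T)
  /-- The transition rates are well-defined. -/
  G_lim : ∀ t ∈ Ico 0 T, ∀ x y,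
    Tendsto (fun τ : ℝ => τ⁻¹ * (Q t (t + τ) x y - if y = x then 1 else 0)) (𝓝[>] 0) (𝓝 (G t x y))
  /-- The transition rates are uniformly bounded. -/
  G_bdd : ∃ C : ℝ, ∀ t ∈ Ico 0 T, ∀ x y, |G t x y| ≤ C

/-! ### Dynamic risk measures

A dynamic risk measure is a family `ϱ`; `ϱ t` is the conditional risk measure that evaluates bounded
functionals of the path on `[0, T]` at time `t`, and `ϱ t Z ξ` is its value at the history `ξ`. -/

/-- Each `ϱ t` maps bounded functionals of the path on `[0, T]` to bounded functionals of the path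
on `[0, t]`. -/
def IsDynamicRiskMeasure {X : Type*} (T : ℝ) (ϱ : ℝ → (Traj X → ℝ) → Traj X → ℝ) : Prop :=
  ∀ t ∈ Icc 0 T, ∀ Z ∈ BddFunctional 0 T, ϱ t Z ∈ BddFunctional 0 t

/-- Coherence of a dynamic risk measure. -/
structure IsCoherent {X : Type*} (T : ℝ) (ϱ : ℝ → (Traj X → ℝ) → Traj X → ℝ) : Prop where
  monotonic : ∀ t ∈ Icc 0 T, ∀ Z ∈ BddFunctional 0 T, ∀ W ∈ BddFunctional 0 T,
    (∀ ω, Z ω ≤ W ω) → ∀ ξ, ϱ t Z ξ ≤ ϱ t W ξ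
  translation : ∀ t ∈ Icc 0 T, ∀ Z ∈ BddFunctional 0 T, ∀ Y ∈ BddFunctional 0 t,
    ∀ ξ, ϱ t (Y + Z) ξ = Y ξ + ϱ t Z ξ
  convex : ∀ t ∈ Icc 0 T, ∀ Z ∈ BddFunctional 0 T, ∀ W ∈ BddFunctional 0 T,
    ∀ α ∈ Icc (0 : ℝ) 1, ∀ ξ, ϱ t (α • Z + (1 - α) • W) ξ ≤ α * ϱ t Z ξ + (1 - α) * ϱ t W ξ
  homogeneous : ∀ t ∈ Icc 0 T, ∀ Z ∈ BddFunctional 0 T, ∀ γ : ℝ, 0 ≤ γ →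
    ∀ ξ, ϱ t (γ • Z) ξ = γ * ϱ t Z ξ

/-- Strong stochastic conditional time consistency. With the history `ξ` up to time `t` fixed, the
functional `ϱ r Z` becomes the random variable `ω ↦ ϱ r Z (Traj.glue t ξ ω)` under the law of the
chain that starts at time `t` in `ξ t`. -/
def StronglyTimeConsistent {X : Type*} [Fintype X] [DecidableEq X] {T : ℝ} (𝒳 : Chain X T)
    (ϱ : ℝ → (Traj X → ℝ) → Traj X → ℝ) : Prop :=
  ∀ t ∈ Icc 0 T, ∀ r₁ ∈ Icc t T, ∀ r₂ ∈ Icc t T, ∀ ξ : Traj X,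
    ∀ Z ∈ BddFunctional 0 T, ∀ W ∈ BddFunctional 0 T,
      (∀ η : ℝ, 𝒳.law t (ξ t) {ω | η < ϱ r₁ Z (Traj.glue t ξ ω)} ≤
        𝒳.law t (ξ t) {ω | η < ϱ r₂ W (Traj.glue t ξ ω)}) →
      ϱ t Z ξ ≤ ϱ t W ξ

/-- The space of measurable, essentially bounded functions on `[a, b] × X`. -/
def EssBddRate {X : Type*} (a b : ℝ) (c : ℝ → X → ℝ) : Prop :=
  ∀ x, MemLp (fun s => c s x) ⊤ (volume.restrict (Icc a b))

/-- The cost on `[t, T]`: the running cost `∫ c_s(X_s) ds` over `[t, T]` plus `f(X_T)`. -/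
noncomputable def cost {X : Type*} (T : ℝ) (c : ℝ → X → ℝ) (f : X → ℝ) (t : ℝ) (ω : Traj X) : ℝ :=
  (∫ s in t..T, c s (ω s)) + f (ω T)

/-- Markovian risk measures. -/
def IsMarkovian {X : Type*} (T : ℝ) (ϱ : ℝ → (Traj X → ℝ) → Traj X → ℝ) : Prop :=
  ∀ t ∈ Icc 0 T, ∀ ξ ξ' : Traj X, ξ t = ξ' t →
    ∀ (c : ℝ → X → ℝ) (f : X → ℝ), EssBddRate t T c →
      ϱ t (cost T c f t) ξ = ϱ t (cost T c f t) ξ'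

/-- The risk value function: `v_t(x)` is the risk at time `t` of the cost on `[t, T]`, for a
history with state `x` at time `t` (for a Markovian risk measure it does not matter which). -/
noncomputable def value {X : Type*} (T : ℝ) (ϱ : ℝ → (Traj X → ℝ) → Traj X → ℝ)
    (c : ℝ → X → ℝ) (f : X → ℝ) (t : ℝ) (x : X) : ℝ :=
  ϱ t (cost T c f t) (Traj.const x)

/-- For a functional `Y` of the path on `[t, r]`, the number `ϱ t Y ξ` is the value at `Y` of the
functional that recovers the risk at time `t` from the risk at time `r`. This functional
is Lipschitz continuous in the space `L_p` of the law of the chain that starts at time `t`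
in `ξ t`, for some finite `p ≥ 1`, with some constant `L`. -/
def LipschitzInLp {X : Type*} [Fintype X] [DecidableEq X] {T : ℝ} (𝒳 : Chain X T)
    (ϱ : ℝ → (Traj X → ℝ) → Traj X → ℝ) : Prop :=
  ∃ p L : ℝ, 1 ≤ p ∧ ∀ t ∈ Icc 0 T, ∀ r ∈ Icc t T, ∀ ξ : Traj X,
    ∀ Y ∈ BddFunctional t r, ∀ Y' ∈ BddFunctional t r,
      |ϱ t Y ξ - ϱ t Y' ξ| ≤ L * (∫ ω, |Y ω - Y' ω| ^ p ∂(𝒳.law t (ξ t))) ^ (1 / p)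

/-! ### Transition risk mappings -/

/-- `σ` is a transition risk mapping of `ϱ`: the risk at time `t` of the random variable `v_r(X_r)`
is `σ_t(ξ_t, Q_{t,r}(· | ξ_t), v_r)`, for all risk value functions `v`. The values of `σ` at other
arguments are not restricted. -/
def IsTransitionRiskMapping {X : Type*} [Fintype X] [DecidableEq X] {T : ℝ} (𝒳 : Chain X T)
    (ϱ : ℝ → (Traj X → ℝ) → Traj X → ℝ) (σ : ℝ → X → (X → ℝ) → (X → ℝ) → ℝ) : Prop :=
  ∀ t ∈ Icc 0 T, ∀ r ∈ Icc t T, ∀ (c : ℝ → X → ℝ) (f : X → ℝ), EssBddRate 0 T c → ∀ ξ : Traj X,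
    ϱ t (fun ω => value T ϱ c f r (ω r)) ξ = σ t (ξ t) (𝒳.Q t r (ξ t)) (value T ϱ c f r)

/-- Coherence of the functional `σ_t(x, m, ·)` for all times, states and probability vectors. -/
structure IsCoherentMapping {X : Type*} [Fintype X] (T : ℝ)
    (σ : ℝ → X → (X → ℝ) → (X → ℝ) → ℝ) : Prop where
  monotonic : ∀ t ∈ Icc 0 T, ∀ x, ∀ m ∈ stdSimplex ℝ X, ∀ v w : X → ℝ,
    (∀ y, v y ≤ w y) → σ t x m v ≤ σ t x m w
  translation : ∀ t ∈ Icc 0 T, ∀ x, ∀ m ∈ stdSimplex ℝ X, ∀ (v : X → ℝ) (a : ℝ),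
    σ t x m (fun y => a + v y) = a + σ t x m v
  convex : ∀ t ∈ Icc 0 T, ∀ x, ∀ m ∈ stdSimplex ℝ X, ∀ v w : X → ℝ, ∀ α ∈ Icc (0 : ℝ) 1,
    σ t x m (α • v + (1 - α) • w) ≤ α * σ t x m v + (1 - α) * σ t x m w
  homogeneous : ∀ t ∈ Icc 0 T, ∀ x, ∀ m ∈ stdSimplex ℝ X, ∀ (v : X → ℝ) (γ : ℝ), 0 ≤ γ →
    σ t x m (γ • v) = γ * σ t x m v

/-- The set `A(x, m)` of the dual representation of a coherent mapping: the subdifferential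
of `σ(x, m, ·)` at `0`. -/
def dualSet {X : Type*} [Fintype X] (σ : X → (X → ℝ) → (X → ℝ) → ℝ) (x : X) (m : X → ℝ) :
    Set (X → ℝ) :=
  {μ | μ ∈ stdSimplex ℝ X ∧ ∀ v : X → ℝ, ∑ y, v y * μ y ≤ σ x m v}

/-! ### Kernels, multikernels and semi-derivatives

A signed kernel is a function `K : X → X → ℝ`, with `K x y` standing for `K(y | x)`. -/

/-- The stochastic kernels. -/
def stochasticKernels (X : Type*) [Fintype X] : Set (X → X → ℝ) :=
  {M | ∀ x, M x ∈ stdSimplex ℝ X}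

/-- The kernel that assigns to each `x` the Dirac measure at `x`. -/
def idKernel (X : Type*) [DecidableEq X] : X → X → ℝ := fun x y => if y = x then 1 else 0

/-- The risk multikernel associated with a mapping `σ`. -/
def multikernel {X : Type*} [Fintype X] (σ : X → (X → ℝ) → (X → ℝ) → ℝ) (Q : X → X → ℝ) :
    Set (X → X → ℝ) :=
  {M | M ∈ stochasticKernels X ∧ ∀ x, M x ∈ dualSet σ x (Q x)}

/-- The norm of a signed kernel: the supremum of `∑ y, φ y * K x y` over `x` and `-1 ≤ φ ≤ 1`. -/
noncomputable def kernelNorm {X : Type*} [Fintype X] (K : X → X → ℝ) : ℝ := ⨆ x, ∑ y, |K x y|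

/-- The distance of a kernel to a set of kernels (`⊤` for the empty set). -/
noncomputable def distToSet {X : Type*} [Fintype X] (K : X → X → ℝ) (B : Set (X → X → ℝ)) :
    ENNReal :=
  ⨅ M ∈ B, ENNReal.ofReal (kernelNorm (K - M))

/-- The Pompeiu-Hausdorff distance. -/
noncomputable def hausdorff {X : Type*} [Fintype X] (S₁ S₂ : Set (X → X → ℝ)) : ENNReal :=
  max (⨆ K ∈ S₁, distToSet K S₂) (⨆ K ∈ S₂, distToSet K S₁)

/-- The difference quotient `τ⁻¹ (B - I)` of a set `B` of kernels. -/
def quotientSet {X : Type*} [DecidableEq X] (τ : ℝ) (B : Set (X → X → ℝ)) : Set (X → X → ℝ) :=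
  (fun M => τ⁻¹ • (M - idKernel X)) '' B

/-- The tangent cone to the set of stochastic kernels at the identity kernel. -/
def tangentConeId (X : Type*) [Fintype X] [DecidableEq X] : Set (X → X → ℝ) :=
  {K | Tendsto (fun τ : ℝ => distToSet K (quotientSet τ (stochasticKernels X))) (𝓝[>] 0) (𝓝 0)}

/-- `D` is the semi-derivative of the multifunction `M` at the identity kernel in the direction `K`. -/
def IsSemiDerivative {X : Type*} [Fintype X] [DecidableEq X]
    (M : (X → X → ℝ) → Set (X → X → ℝ)) (K : X → X → ℝ) (D : Set (X → X → ℝ)) : Prop :=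
  D.Nonempty ∧ ∀ (ε : ℕ → ℝ) (k : ℕ → X → X → ℝ),
    (∀ n, 0 < ε n) → Tendsto ε atTop (𝓝 0) →
    (∀ n, k n ∈ tangentConeId X) → Tendsto (fun n => kernelNorm (k n - K)) atTop (𝓝 0) →
    Tendsto (fun n => hausdorff (quotientSet (ε n) (M (idKernel X + ε n • k n))) D) atTop (𝓝 0)

/-- The risk multigenerator at the state `x` that belongs to a semi-derivative `D`. -/
def multigenerator {X : Type*} (D : Set (X → X → ℝ)) (x : X) : Set (X → ℝ) :=
  (fun d => d x) '' D

/-- The support function of a set of signed measures. -/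
noncomputable def supportFn {X : Type*} [Fintype X] (A : Set (X → ℝ)) (v : X → ℝ) : ℝ :=
  sSup ((fun l : X → ℝ => ∑ y, l y * v y) '' A)

/-! ### The backward system -/

/-- `u` solves the backward system `du_t(x)/dt = -c_t(x) - s_{𝔊_t(x)}(u_t)`, `u_T = f` on `[0, T]`,
in the sense of Caratheodory: it is absolutely continuous in `t`, and the
equation holds for almost all `t`. -/
structure IsBackwardSolution {X : Type*} [Fintype X] (T : ℝ) (c : ℝ → X → ℝ) (f : X → ℝ)
    (𝔊 : ℝ → X → Set (X → ℝ)) (u : ℝ → X → ℝ) : Prop where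
  absCont : ∀ x, AbsolutelyContinuousOnInterval (fun t => u t x) 0 T
  equation : ∀ x, ∀ᵐ t ∂(volume.restrict (Icc 0 T)),
    HasDerivAt (fun t => u t x) (-c t x - supportFn (𝔊 t x) (u t)) t
  terminal : ∀ x, u T x = f x

end CTMCRisk

open CTMCRisk

namespace CTMCRisk

section

variable {X : Type*}

/-! Strong time consistency, applied in both directions at the intermediate time `r`, gives the
dynamic programming equation: `v_t(x)` is the risk at `t` of `∫_t^r c_s(X_s) ds + v_r(X_r)`
(`StronglyTimeConsistent.value_eq`). The chain leaves `x` before `r` with probability at most `g (r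
- t)`, where `g` bounds the rates. By the Lipschitz property in `L_p`, freezing the running cost at
the state `x` therefore costs `O((r - t)^(1 + 1/p)) = o(r - t)`, so that `v_t(x) = ∫_t^r c_s(x) ds +
σ_t(x, Q_{t,r}(x), v_r) + o(r - t)` (`abs_value_sub_risk_le`).

By Hahn-Banach, `σ_t(x, Q(x), ·)` is the maximum of the pairings with the rows of the risk
multikernel. Hence the quotient of `σ_t(x, Q_{t,r}(x), v_r) - v_r(x)` by `r - t` is the support
function of a difference quotient of that multikernel. Hausdorff convergence to the semi-derivative,
with right continuity of `v`, turns it into the support function of the multigenerator at `v_t`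
(`tendsto_transitionRisk_slope`).

So `φ_t = v_t(x) + ∫_0^t c_s(x) ds` has the right derivative `-s(v_t)`, with `s` the support
function of the multigenerator at `x`, at every `t < T`. This derivative is bounded and `φ` is
continuous, hence `φ` is Lipschitz and differentiable almost everywhere; Lebesgue differentiation of
the integral then yields the equation. Uniqueness is Grönwall's inequality, since support functions
of uniformly bounded sets are uniformly Lipschitz. -/

theorem EssBddRate.mono {a b a' b' : ℝ} {c : ℝ → X → ℝ} (hc : EssBddRate a b c)
    (h : Icc a' b' ⊆ Icc a b) : EssBddRate a' b' c := fun x =>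
  (hc x).mono_measure (Measure.restrict_mono_set _ h)

/-- No regularity of `y` is needed: the exceptional null set does not depend on the state, and the
integral of a non-integrable function is zero. -/
theorem abs_integral_rate_path_le (y : ℝ → X) {a b C : ℝ} (hab : a ≤ b) {c : ℝ → X → ℝ}
    (hC : ∀ᵐ s ∂volume.restrict (Icc a b), ∀ x, |c s x| ≤ C) :
    |∫ s in a..b, c s (y s)| ≤ C * (b - a) := by
  have h := intervalIntegral.norm_integral_le_of_norm_le_const_ae (a := a) (b := b) (C := C)
    (f := fun s => c s (y s)) ?_
  · rwa [abs_of_nonneg (sub_nonneg.2 hab)] at h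
  · rw [uIoc_of_le hab, ← ae_restrict_iff' measurableSet_Ioc]
    filter_upwards [ae_restrict_of_ae_restrict_of_subset Ioc_subset_Icc_self hC] with s hs
    exact hs _

end

/-! ### Joint measurability of right-continuous processes and integrals along them -/

section RightContinuousProcess

variable {Ω X : Type*} [MeasurableSpace Ω] {Y : Ω → ℝ → X}

/-- The grid points `ρ n s` lie to the right of `s` and converge to it, so by right continuity the
state at `ρ n s` is eventually the state at `s`. The set is thus a lower limit of countable unions
of measurable rectangles. -/
theorem measurableSet_process_eq (hY : ∀ s x, MeasurableSet {ω | Y ω s = x})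
    (hrc : ∀ ω s, ∀ᶠ u in 𝓝[≥] s, Y ω u = Y ω s) (x : X) :
    MeasurableSet {p : Ω × ℝ | Y p.1 p.2 = x} := by
  -- Adding one to the floor puts the grid point to the right of `s`; the mesh is `1 / (n + 1)` to
  -- avoid division by zero.
  set ρ : ℕ → ℝ → ℝ := fun n s => ((⌊((n : ℝ) + 1) * s⌋ : ℝ) + 1) / ((n : ℝ) + 1) with hρ
  have hn : ∀ n : ℕ, (0 : ℝ) < (n : ℝ) + 1 := fun n => by positivity
  have hρs : ∀ s, Tendsto (fun n => ρ n s) atTop (𝓝[≥] s) := by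
    intro s
    have hlow : ∀ n, s ≤ ρ n s := fun n => by
      rw [hρ, le_div_iff₀ (hn n)]
      have := Int.lt_floor_add_one (((n : ℝ) + 1) * s)
      linarith
    have hup : ∀ n : ℕ, ρ n s ≤ s + 1 / ((n : ℝ) + 1) := fun n => by
      have h1 := Int.floor_le (((n : ℝ) + 1) * s)
      have h2 : (s + 1 / ((n : ℝ) + 1)) * ((n : ℝ) + 1) = ((n : ℝ) + 1) * s + 1 := by
        field_simp
      rw [hρ, div_le_iff₀ (hn n), h2]
      linarith
    refine tendsto_nhdsWithin_iff.2 ⟨?_, Eventually.of_forall hlow⟩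
    refine tendsto_of_tendsto_of_tendsto_of_le_of_le tendsto_const_nhds ?_ hlow hup
    simpa using tendsto_const_nhds.add (tendsto_one_div_add_atTop_nhds_zero_nat (𝕜 := ℝ))
  have hset : {p : Ω × ℝ | Y p.1 p.2 = x} =
      ⋃ N : ℕ, ⋂ n ≥ N, {p : Ω × ℝ | Y p.1 (ρ n p.2) = x} := by
    ext ⟨ω, s⟩
    have h := (hρs s).eventually (hrc ω s)
    simp only [mem_ofPred_eq, mem_iUnion, mem_iInter]
    obtain ⟨N, hN⟩ := eventually_atTop.1 h
    constructor
    · exact fun hx => ⟨N, fun n hn => (hN n hn).trans hx⟩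
    · rintro ⟨M, hM⟩
      rw [← hN (max M N) (le_max_right _ _)]
      exact hM _ (le_max_left _ _)
  rw [hset]
  refine MeasurableSet.iUnion fun N => MeasurableSet.iInter fun n => MeasurableSet.iInter fun _ => ?_
  have hset' : {p : Ω × ℝ | Y p.1 (ρ n p.2) = x} =
      ⋃ k : ℤ, {ω | Y ω (((k : ℝ) + 1) / ((n : ℝ) + 1)) = x} ×ˢ
        {s : ℝ | ⌊((n : ℝ) + 1) * s⌋ = k} := by
    ext ⟨ω, s⟩
    simp [hρ]
  rw [hset']
  refine MeasurableSet.iUnion fun k => (hY _ _).prod ?_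
  exact (Int.measurable_floor.comp (measurable_const_mul ((n : ℝ) + 1))) (measurableSet_singleton k)

variable [Fintype X]

/-- Essential boundedness of the running cost on `[a, b]`. -/
theorem EssBddRate.exists_bound {a b : ℝ} {c : ℝ → X → ℝ} (hc : EssBddRate a b c) :
    ∃ C : ℝ, 0 ≤ C ∧ ∀ᵐ s ∂volume.restrict (Icc a b), ∀ x, |c s x| ≤ C := by
  have h : ∀ x, ∃ C : ℝ, ∀ᵐ s ∂volume.restrict (Icc a b), |c s x| ≤ C := fun x =>
    ⟨_, by simpa using ae_le_lpNorm_exponent_top (hc x)⟩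
  choose C hC using h
  refine ⟨∑ x, |C x|, Finset.sum_nonneg fun _ _ => abs_nonneg _, ?_⟩
  filter_upwards [ae_all_iff.2 hC] with s hs x
  exact (hs x).trans ((le_abs_self _).trans
    (Finset.single_le_sum (f := fun x => |C x|) (fun _ _ => abs_nonneg _) (Finset.mem_univ x)))

/-- Since there are finitely many states, one null set serves them all, so the two rates agree
almost everywhere along every path. -/
theorem exists_measurable_rate {a b : ℝ} {c : ℝ → X → ℝ} (hc : EssBddRate a b c) :
    ∃ c' : ℝ → X → ℝ, (∀ x, Measurable fun s => c' s x) ∧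
      ∀ᵐ s ∂volume.restrict (Icc a b), ∀ x, c s x = c' s x := by
  refine ⟨fun s x => (hc x).1.mk _ s, fun x => (hc x).1.stronglyMeasurable_mk.measurable, ?_⟩
  exact ae_all_iff.2 fun x => (hc x).1.ae_eq_mk

theorem measurable_rate_process (hY : ∀ s x, MeasurableSet {ω | Y ω s = x})
    (hrc : ∀ ω s, ∀ᶠ u in 𝓝[≥] s, Y ω u = Y ω s) {c : ℝ → X → ℝ}
    (hc : ∀ x, Measurable fun s => c s x) :
    Measurable fun p : Ω × ℝ => c p.2 (Y p.1 p.2) := by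
  classical
  have h : (fun p : Ω × ℝ => c p.2 (Y p.1 p.2)) = fun p =>
      ∑ x, {p : Ω × ℝ | Y p.1 p.2 = x}.indicator (fun p => c p.2 x) p := by
    ext p
    simp [indicator_apply]
  rw [h]
  exact Finset.measurable_sum _ fun x _ =>
    ((hc x).comp measurable_snd).indicator (measurableSet_process_eq hY hrc x)

theorem measurable_integral_process (hY : ∀ s x, MeasurableSet {ω | Y ω s = x})
    (hrc : ∀ ω s, ∀ᶠ u in 𝓝[≥] s, Y ω u = Y ω s) {a b : ℝ} (hab : a ≤ b) {c : ℝ → X → ℝ}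
    (hc : EssBddRate a b c) :
    Measurable fun ω => ∫ s in a..b, c s (Y ω s) := by
  obtain ⟨c', hc', hcc⟩ := exists_measurable_rate hc
  have h : (fun ω => ∫ s in a..b, c s (Y ω s)) = fun ω => ∫ s in Ioc a b, c' s (Y ω s) := by
    ext ω
    rw [intervalIntegral.integral_of_le hab]
    refine integral_congr_ae ?_
    filter_upwards [ae_restrict_of_ae_restrict_of_subset Ioc_subset_Icc_self hcc] with s hs
    exact hs _
  rw [h]
  exact ((measurable_rate_process hY hrc hc').stronglyMeasurable.integral_prod_right
    (ν := volume.restrict (Ioc a b))).measurable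

theorem intervalIntegrable_rate_path {y : ℝ → X} (hy : ∀ s, ∀ᶠ u in 𝓝[≥] s, y u = y s)
    {a b : ℝ} (hab : a ≤ b) {c : ℝ → X → ℝ} (hc : EssBddRate a b c) :
    IntervalIntegrable (fun s => c s (y s)) volume a b := by
  obtain ⟨c', hc', hcc⟩ := exists_measurable_rate hc
  obtain ⟨C, -, hC⟩ := hc.exists_bound
  rw [intervalIntegrable_iff_integrableOn_Icc_of_le hab]
  have hm : Measurable fun s => c' s (y s) :=
    -- A single path is a process on a one-point probability space.
    (measurable_rate_process (Ω := Unit) (Y := fun _ => y) (fun s x => MeasurableSet.const _)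
      (fun _ => hy) hc').comp (measurable_const (a := ()) |>.prodMk measurable_id)
  refine Integrable.of_bound (C := C) ?_ ?_
  · refine hm.aestronglyMeasurable.congr ?_
    filter_upwards [hcc] with s hs
    exact (hs _).symm
  · filter_upwards [hC] with s hs
    exact hs _

end RightContinuousProcess

/-! ### Bounded functionals of trajectories -/

section Trajectories

variable {X : Type*}

theorem Traj.eventually_eq (ω : Traj X) (s : ℝ) : ∀ᶠ u in 𝓝[≥] s, ω u = ω s := by
  obtain ⟨F, hF⟩ := ω.2
  have h : ∀ᶠ u in 𝓝[≥] s, ∀ a ∈ F, ¬ (s < a ∧ a ≤ u) := by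
    rw [Finset.eventually_all]
    intro a _
    by_cases ha : s < a
    · filter_upwards [nhdsWithin_le_nhds (Iio_mem_nhds ha)] with u hu h
      exact absurd hu (not_lt.2 h.2)
    · exact Eventually.of_forall fun u h => ha h.1
  filter_upwards [h, self_mem_nhdsWithin] with u hu hsu
  exact (hF s u hsu hu).symm

theorem measurableSet_hist_state {a b s : ℝ} (hs : s ∈ Icc a b) (A : Set X) :
    MeasurableSet[hist a b] {ω : Traj X | ω s ∈ A} := by
  have h : MeasurableSpace.comap (fun ω : Traj X => ω s) ⊤ ≤ hist a b :=
    le_iSup₂_of_le (f := fun s (_ : s ∈ Icc a b) =>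
      MeasurableSpace.comap (fun ω : Traj X => ω s) ⊤) s hs le_rfl
  exact h _ ⟨A, trivial, rfl⟩

theorem hist_mono {a b a' b' : ℝ} (h : Icc a' b' ⊆ Icc a b) :
    (hist a' b' : MeasurableSpace (Traj X)) ≤ hist a b :=
  iSup₂_le fun s hs => le_iSup₂_of_le (f := fun s (_ : s ∈ Icc a b) =>
      MeasurableSpace.comap (fun ω : Traj X => ω s) ⊤) s (h hs) le_rfl

theorem hist_le (a b : ℝ) : hist a b ≤ (inferInstance : MeasurableSpace (Traj X)) :=
  iSup₂_le fun s _ => le_iSup (fun s => MeasurableSpace.comap (fun ω : Traj X => ω s) ⊤) s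

theorem measurableSet_state (s : ℝ) (A : Set X) : MeasurableSet {ω : Traj X | ω s ∈ A} :=
  hist_le s s _ (measurableSet_hist_state (left_mem_Icc.2 le_rfl) A)

theorem BddFunctional.mono {a b a' b' : ℝ} (h : Icc a' b' ⊆ Icc a b) {Z : Traj X → ℝ}
    (hZ : Z ∈ BddFunctional a' b') : Z ∈ BddFunctional a b :=
  ⟨hZ.1.mono (hist_mono h) le_rfl, hZ.2⟩

theorem BddFunctional.add {a b : ℝ} {Z W : Traj X → ℝ}
    (hZ : Z ∈ BddFunctional a b) (hW : W ∈ BddFunctional a b) : Z + W ∈ BddFunctional a b := by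
  obtain ⟨hZm, C, hC⟩ := hZ
  obtain ⟨hWm, D, hD⟩ := hW
  exact ⟨hZm.add hWm, C + D, fun ω => (abs_add_le _ _).trans (add_le_add (hC ω) (hD ω))⟩

theorem BddFunctional.const {a b : ℝ} (k : ℝ) : (fun _ : Traj X => k) ∈ BddFunctional a b :=
  ⟨measurable_const, |k|, fun _ => le_rfl⟩

variable [Fintype X]

theorem BddFunctional.state {a b s : ℝ} (hs : s ∈ Icc a b) (g : X → ℝ) :
    (fun ω : Traj X => g (ω s)) ∈ BddFunctional a b := by
  refine ⟨fun A _ => measurableSet_hist_state hs (g ⁻¹' A), ∑ x, |g x|, fun ω => ?_⟩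
  exact Finset.single_le_sum (f := fun x => |g x|) (fun _ _ => abs_nonneg _) (Finset.mem_univ _)

theorem BddFunctional.integral {a b : ℝ} (hab : a ≤ b) {c : ℝ → X → ℝ} (hc : EssBddRate a b c) :
    (fun ω : Traj X => ∫ s in a..b, c s (ω s)) ∈ BddFunctional a b := by
  constructor
  -- Clamping time to `[a, b]` makes the process `hist a b`-measurable at every real time. The clamp
  -- is continuous and monotone, so right continuity survives.
  · have hclamp : ∀ s ∈ uIcc a b, max a (min b s) = s := fun s hs => by
      rw [uIcc_of_le hab] at hs
      rw [min_eq_right hs.2, max_eq_right hs.1]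
    have h : (fun ω : Traj X => ∫ s in a..b, c s (ω s)) =
        fun ω => ∫ s in a..b, c s (ω (max a (min b s))) := by
      ext ω
      refine intervalIntegral.integral_congr fun s hs => ?_
      simp only [hclamp s hs]
    rw [h]
    refine @measurable_integral_process (Traj X) X (hist a b) (fun ω s => ω (max a (min b s)))
      _ ?_ ?_ a b hab c hc
    · exact fun s x => measurableSet_hist_state ⟨le_max_left _ _, by simp [hab]⟩ {x}
    · intro ω s
      have ht : Tendsto (fun u => max a (min b u)) (𝓝[≥] s) (𝓝[≥] (max a (min b s))) := by
        refine tendsto_nhdsWithin_iff.2 ⟨?_, ?_⟩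
        · exact ((by fun_prop : Continuous fun u => max a (min b u)).tendsto s).mono_left
            nhdsWithin_le_nhds
        · filter_upwards [self_mem_nhdsWithin] with u hu
          exact max_le_max_left _ (min_le_min_left _ (mem_Ici.1 hu))
      exact ht.eventually (ω.eventually_eq _)
  · obtain ⟨C, -, hC⟩ := hc.exists_bound
    exact ⟨_, fun ω => abs_integral_rate_path_le ω hab hC⟩

theorem BddFunctional.cost {t T : ℝ} (h : t ≤ T) {c : ℝ → X → ℝ} (hc : EssBddRate t T c)
    (f : X → ℝ) : cost T c f t ∈ BddFunctional t T :=
  BddFunctional.add (BddFunctional.integral h hc) (BddFunctional.state ⟨h, le_rfl⟩ f)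

theorem cost_eq_integral_add {t r T : ℝ} (htr : t ≤ r) (hrT : r ≤ T) {c : ℝ → X → ℝ}
    (hc : EssBddRate t T c) (f : X → ℝ) :
    cost T c f t = (fun ω : Traj X => ∫ s in t..r, c s (ω s)) + cost T c f r := by
  ext ω
  have h1 := intervalIntegrable_rate_path ω.eventually_eq htr (hc.mono (Icc_subset_Icc_right hrT))
  have h2 := intervalIntegrable_rate_path ω.eventually_eq hrT (hc.mono (Icc_subset_Icc_left htr))
  simp only [CTMCRisk.cost, Pi.add_apply]
  rw [← intervalIntegral.integral_add_adjacent_intervals h1 h2, add_assoc]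

end Trajectories

/-! ### Transition probabilities and the probability of leaving a state -/

section

namespace Chain

variable {X : Type*} [Fintype X] [DecidableEq X] {T : ℝ} (𝒳 : Chain X T)

theorem law_two {t s : ℝ} (ht : 0 ≤ t) (hts : t ≤ s) (hs : s ≤ T) (x y : X) :
    𝒳.law t x {ω | ω t = x ∧ ω s = y} = ENNReal.ofReal (𝒳.Q t s x y) := by
  have h := 𝒳.law_fdd t ⟨ht, hts.trans hs⟩ x 1 (fun i => if i = 0 then t else s)
    (fun i => if i = 0 then x else y) (by simp) (by simp [hts]) (by simpa using hs) (by simp)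
  simp only [Finset.range_one, Finset.prod_singleton] at h
  simp only [↓reduceIte, zero_add, one_ne_zero] at h
  rw [← h]
  congr 1
  ext ω
  simp only [mem_ofPred_eq]
  constructor
  · rintro ⟨h0, h1⟩ i hi
    interval_cases i <;> simp [h0, h1]
  · intro h
    exact ⟨by simpa using h 0 (by simp), by simpa using h 1 le_rfl⟩

theorem law_three {t s r : ℝ} (ht : 0 ≤ t) (hts : t ≤ s) (hsr : s ≤ r) (hr : r ≤ T) (x z y : X) :
    𝒳.law t x {ω | ω s = z ∧ ω t = x ∧ ω r = y} =
      ENNReal.ofReal (𝒳.Q t s x z * 𝒳.Q s r z y) := by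
  have h := 𝒳.law_fdd t ⟨ht, hts.trans (hsr.trans hr)⟩ x 2
    (fun i => if i = 0 then t else if i = 1 then s else r)
    (fun i => if i = 0 then x else if i = 1 then z else y) (by simp)
    (by intro i hi; interval_cases i <;> simp [hts, hsr]) (by simpa using hr) (by simp)
  rw [Finset.prod_range_succ, Finset.prod_range_one] at h
  simp only [↓reduceIte, zero_add, one_ne_zero, Nat.reduceAdd, OfNat.ofNat_ne_zero,
    OfNat.ofNat_ne_one] at h
  rw [← h]
  congr 1
  ext ω
  simp only [mem_ofPred_eq]
  constructor
  · rintro ⟨h1, h0, h2⟩ i hi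
    interval_cases i <;> simp [h0, h1, h2]
  · intro h
    exact ⟨by simpa using h 1 (by simp), by simpa using h 0 (by simp), by simpa using h 2 le_rfl⟩

theorem Q_nonneg {t s : ℝ} (ht : 0 ≤ t) (hts : t ≤ s) (hs : s ≤ T) (x y : X) :
    0 ≤ 𝒳.Q t s x y := (𝒳.Q_mem t s ht hts hs x).1 y

/-- For `y ≠ x` the path cannot be in both states at time `t`, so the two-time law gives `Q t t x y
= 0`; the total mass one remains for `x`. -/
theorem Q_self {t : ℝ} (ht : 0 ≤ t) (hT : t ≤ T) (x : X) : 𝒳.Q t t x x = 1 := by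
  have h := (𝒳.Q_mem t t ht le_rfl hT x).2
  rw [Finset.sum_eq_single x] at h
  · exact h
  · intro y _ hy
    have h2 := 𝒳.law_two ht le_rfl hT x y
    have h3 : {ω : Traj X | ω t = x ∧ ω t = y} = ∅ := by
      ext ω
      simp only [mem_ofPred_eq, mem_empty_iff_false, iff_false, not_and]
      rintro rfl
      exact fun h => hy h.symm
    rw [h3, measure_empty] at h2
    exact le_antisymm (ENNReal.ofReal_eq_zero.1 h2.symm) (𝒳.Q_nonneg ht le_rfl hT x y)
  · simp

/-- Marginalisation of the three-time law over the state at the intermediate time. -/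
theorem chapman_kolmogorov {t s r : ℝ} (ht : 0 ≤ t) (hts : t ≤ s) (hsr : s ≤ r) (hr : r ≤ T)
    (x y : X) : 𝒳.Q t r x y = ∑ z, 𝒳.Q t s x z * 𝒳.Q s r z y := by
  have h2 := 𝒳.law_two ht (hts.trans hsr) hr x y
  have h3 : ∑ z, 𝒳.law t x {ω | ω s = z ∧ ω t = x ∧ ω r = y} =
      𝒳.law t x {ω | ω t = x ∧ ω r = y} := by
    have hB : MeasurableSet {ω : Traj X | ω t = x ∧ ω r = y} :=
      (measurableSet_state t {x}).inter (measurableSet_state r {y})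
    have h := sum_measure_preimage_singleton (μ := (𝒳.law t x).restrict {ω | ω t = x ∧ ω r = y})
      (Finset.univ : Finset X) (f := fun ω : Traj X => ω s) fun z _ => measurableSet_state s {z}
    rw [Finset.coe_univ, preimage_univ, Measure.restrict_apply_univ] at h
    rw [← h]
    refine Finset.sum_congr rfl fun z _ => ?_
    exact (Measure.restrict_apply (measurableSet_state s {z})).symm
  rw [h2, Finset.sum_congr rfl fun z _ => 𝒳.law_three ht hts hsr hr x z y,
    ← ENNReal.ofReal_sum_of_nonneg fun z _ => mul_nonneg
      (𝒳.Q_nonneg ht hts (hsr.trans hr) x z) (𝒳.Q_nonneg (ht.trans hts) hsr hr z y)] at h3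
  refine ((ENNReal.ofReal_eq_ofReal_iff ?_ ?_).1 h3).symm
  · exact Finset.sum_nonneg fun z _ => mul_nonneg
      (𝒳.Q_nonneg ht hts (hsr.trans hr) x z) (𝒳.Q_nonneg (ht.trans hts) hsr hr z y)
  · exact 𝒳.Q_nonneg ht (hts.trans hsr) hr x y

/-- The probability of having left the initial state. -/
theorem law_ne_le {t s : ℝ} (ht : 0 ≤ t) (hts : t ≤ s) (hs : s ≤ T) (x : X) :
    (𝒳.law t x).real {ω | ω s ≠ x} ≤ 1 - 𝒳.Q t s x x := by
  have := 𝒳.law_prob t ⟨ht, hts.trans hs⟩ x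
  have h1 : (𝒳.law t x).real {ω | ω s ≠ x} = 1 - (𝒳.law t x).real {ω | ω s = x} :=
    probReal_compl_eq_one_sub (measurableSet_state s {x})
  have h2 : 𝒳.Q t s x x ≤ (𝒳.law t x).real {ω | ω s = x} := by
    have h3 : (𝒳.law t x).real {ω | ω t = x ∧ ω s = x} = 𝒳.Q t s x x := by
      rw [measureReal_def, 𝒳.law_two ht hts hs, ENNReal.toReal_ofReal (𝒳.Q_nonneg ht hts hs x x)]
    rw [← h3]
    exact measureReal_mono fun ω h => h.2
  linarith

/-- The forward Kolmogorov equation, from the right: Chapman-Kolmogorov at `r` reduces the increment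
to transitions out of `r`, whose slopes converge by the definition of the rates. -/
theorem hasDerivWithinAt_Q {t r : ℝ} (ht : 0 ≤ t) (htr : t ≤ r) (hr : r < T) (x y : X) :
    HasDerivWithinAt (fun r => 𝒳.Q t r x y) (∑ z, 𝒳.Q t r x z * 𝒳.G r z y) (Ici r) r := by
  rw [← hasDerivWithinAt_Ioi_iff_Ici, hasDerivWithinAt_iff_tendsto_slope' self_notMem_Ioi]
  have hsub : Tendsto (fun u => u - r) (𝓝[>] r) (𝓝[>] 0) := by
    refine tendsto_nhdsWithin_iff.2 ⟨?_, ?_⟩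
    · have h : Tendsto (fun u => u - r) (𝓝 r) (𝓝 (r - r)) :=
        (continuous_id.sub continuous_const).tendsto r
      rw [sub_self] at h
      exact h.mono_left nhdsWithin_le_nhds
    · filter_upwards [self_mem_nhdsWithin] with u hu
      exact sub_pos.2 (mem_Ioi.1 hu)
  have hlim : Tendsto (fun u => ∑ z, 𝒳.Q t r x z * ((u - r)⁻¹ *
      (𝒳.Q r (r + (u - r)) z y - if y = z then 1 else 0))) (𝓝[>] r)
      (𝓝 (∑ z, 𝒳.Q t r x z * 𝒳.G r z y)) :=
    tendsto_finsetSum _ fun z _ =>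
      ((𝒳.G_lim r ⟨ht.trans htr, hr⟩ z y).comp hsub).const_mul _
  refine hlim.congr' ?_
  filter_upwards [Ioo_mem_nhdsGT hr] with u hu
  rw [slope_def_field, 𝒳.chapman_kolmogorov ht htr hu.1.le hu.2.le x y, add_sub_cancel]
  have h : 𝒳.Q t r x y = ∑ z, 𝒳.Q t r x z * if y = z then 1 else 0 := by simp
  rw [h]
  rw [← Finset.sum_sub_distrib, div_eq_inv_mul, Finset.mul_sum]
  exact Finset.sum_congr rfl fun z _ => by ring

/-- The definition of the rates only gives this in the limit, separately for each `t`. The forward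
equation makes it uniform: its right-hand side is an average of rates, hence at most `g` in absolute
value. -/
theorem one_sub_Q_le {g : ℝ} (hg : ∀ t ∈ Ico 0 T, ∀ x y, |𝒳.G t x y| ≤ g) {t r : ℝ}
    (ht : 0 ≤ t) (htr : t ≤ r) (hr : r ≤ T) (x : X) : 1 - 𝒳.Q t r x x ≤ g * (r - t) := by
  have h := norm_image_sub_le_of_norm_deriv_right_le_segment (f := fun r => 𝒳.Q t r x x)
    (f' := fun r => ∑ z, 𝒳.Q t r x z * 𝒳.G r z x) (C := g) (a := t) (b := r)
    ((𝒳.Q_cont t ⟨ht, htr.trans hr⟩ x x).mono (Icc_subset_Icc_right hr))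
    (fun s hs => 𝒳.hasDerivWithinAt_Q ht hs.1 (hs.2.trans_le hr) x x)
    (fun s hs => by
      have hsT := hs.2.trans_le hr
      calc ‖∑ z, 𝒳.Q t s x z * 𝒳.G s z x‖ ≤ ∑ z, 𝒳.Q t s x z * g := by
            refine norm_sum_le_of_le _ fun z _ => ?_
            rw [norm_mul, Real.norm_of_nonneg (𝒳.Q_nonneg ht hs.1 hsT.le x z)]
            exact mul_le_mul_of_nonneg_left (hg s ⟨ht.trans hs.1, hsT⟩ z x)
              (𝒳.Q_nonneg ht hs.1 hsT.le x z)
        _ = g := by rw [← Finset.sum_mul, (𝒳.Q_mem t s ht hs.1 hsT.le x).2, one_mul])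
    r ⟨htr, le_rfl⟩
  rw [𝒳.Q_self ht (htr.trans hr)] at h
  linarith [(abs_le.1 h).1]

end Chain

/-! ### Moments of the time spent away from the initial state -/

/-- As `0 ≤ B ≤ 1` and `p ≥ 1`, `B ^ p ≤ B`, so a bound on the mean of `B` controls the `L_p` norm.
Here `B` will be the indicator of having left a state, or the fraction of time spent away from it.
-/
theorem rpow_integral_rpow_le {Ω : Type*} [MeasurableSpace Ω] {μ : Measure Ω} {D B : Ω → ℝ}
    {K β p : ℝ} (hp : 1 ≤ p) (hK : 0 ≤ K) (hB0 : ∀ ω, 0 ≤ B ω) (hB1 : ∀ ω, B ω ≤ 1)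
    (hD : ∀ ω, |D ω| ≤ K * B ω) (hB : Integrable B μ) (hβ : ∫ ω, B ω ∂μ ≤ β) :
    (∫ ω, |D ω| ^ p ∂μ) ^ (1 / p) ≤ K * β ^ (1 / p) := by
  have hp0 : 0 < p := by linarith
  have hβ0 : 0 ≤ β := (integral_nonneg hB0).trans hβ
  have h1 : ∫ ω, |D ω| ^ p ∂μ ≤ K ^ p * β := by
    calc ∫ ω, |D ω| ^ p ∂μ ≤ ∫ ω, K ^ p * B ω ∂μ := by
          refine integral_mono_of_nonneg (Eventually.of_forall fun ω => by positivity)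
            (hB.const_mul _) (Eventually.of_forall fun ω => ?_)
          calc |D ω| ^ p ≤ (K * B ω) ^ p := Real.rpow_le_rpow (abs_nonneg _) (hD ω) hp0.le
            _ = K ^ p * B ω ^ p := Real.mul_rpow hK (hB0 ω)
            _ ≤ K ^ p * B ω := mul_le_mul_of_nonneg_left
                (Real.rpow_le_self_of_le_one (hB0 ω) (hB1 ω) hp) (by positivity)
      _ = K ^ p * ∫ ω, B ω ∂μ := integral_const_mul _ _
      _ ≤ K ^ p * β := by gcongr
  calc (∫ ω, |D ω| ^ p ∂μ) ^ (1 / p) ≤ (K ^ p * β) ^ (1 / p) :=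
        Real.rpow_le_rpow (integral_nonneg fun ω => by positivity) h1 (by positivity)
    _ = K * β ^ (1 / p) := by
        rw [Real.mul_rpow (by positivity) hβ0, one_div, Real.rpow_rpow_inv hK hp0.ne']

variable {X : Type*} [DecidableEq X]

/-- Fubini turns the expected time away from `x` into the integral of the probabilities of being
away. -/
theorem integral_away_le {μ : Measure (Traj X)} [IsProbabilityMeasure μ] {a b q : ℝ} (hab : a ≤ b)
    (x : X) (hq : ∀ s ∈ Icc a b, μ.real {ω | ω s ≠ x} ≤ q) :
    ∫ ω, (∫ s in a..b, if ω s = x then (0 : ℝ) else 1) ∂μ ≤ q * (b - a) := by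
  have hm : Measurable fun p : Traj X × ℝ => if p.1 p.2 = x then (0 : ℝ) else 1 :=
    Measurable.ite (measurableSet_process_eq (Y := fun (ω : Traj X) s => ω s)
      (fun s x => measurableSet_state s {x}) (fun ω => ω.eventually_eq) x)
      measurable_const measurable_const
  have hint : Integrable (fun p : Traj X × ℝ => if p.1 p.2 = x then (0 : ℝ) else 1)
      (μ.prod (volume.restrict (Ioc a b))) := by
    refine Integrable.of_bound (C := 1) hm.aestronglyMeasurable (Eventually.of_forall fun p => ?_)
    split_ifs <;> simp
  simp_rw [intervalIntegral.integral_of_le hab]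
  rw [integral_integral_swap hint, ← intervalIntegral.integral_of_le hab]
  refine (le_abs_self _).trans ?_
  have h := intervalIntegral.norm_integral_le_of_norm_le_const (a := a) (b := b) (C := q)
    (f := fun s => ∫ ω : Traj X, (if ω s = x then (0 : ℝ) else 1) ∂μ) ?_
  · rwa [abs_of_nonneg (sub_nonneg.2 hab)] at h
  · intro s hs
    rw [uIoc_of_le hab] at hs
    have h2 : (fun ω : Traj X => if ω s = x then (0 : ℝ) else 1) =
        {ω : Traj X | ω s ≠ x}.indicator 1 := by
      ext ω
      simp [indicator_apply, ite_not]
    have h3 : ∫ ω : Traj X, {ω : Traj X | ω s ≠ x}.indicator 1 ω ∂μ = μ.real {ω | ω s ≠ x} :=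
      integral_indicator_one (measurableSet_state s {x}ᶜ)
    rw [h2, h3, Real.norm_of_nonneg measureReal_nonneg]
    exact hq s (Ioc_subset_Icc_self hs)

end

/-! ### Dynamic programming and its expansion over short intervals -/

section RiskMeasure

variable {X : Type*} {T : ℝ} {ϱ : ℝ → (Traj X → ℝ) → Traj X → ℝ}

theorem IsCoherent.risk_zero (hcoh : IsCoherent T ϱ) {t : ℝ} (ht : t ∈ Icc 0 T) (ξ : Traj X) :
    ϱ t 0 ξ = 0 := by
  have h := hcoh.homogeneous t ht 0 (BddFunctional.const 0) 0 le_rfl ξ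
  rwa [zero_smul, zero_mul] at h

theorem IsCoherent.risk_of_mem (hcoh : IsCoherent T ϱ) {t : ℝ} (ht : t ∈ Icc 0 T)
    {Y : Traj X → ℝ} (hY : Y ∈ BddFunctional 0 t) (ξ : Traj X) : ϱ t Y ξ = Y ξ := by
  have h := hcoh.translation t ht 0 (BddFunctional.const 0) Y hY ξ
  rwa [add_zero, hcoh.risk_zero ht, add_zero] at h

theorem IsCoherent.risk_const_add (hcoh : IsCoherent T ϱ) {t : ℝ} (ht : t ∈ Icc 0 T) (k : ℝ)
    {Z : Traj X → ℝ} (hZ : Z ∈ BddFunctional 0 T) (ξ : Traj X) :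
    ϱ t (fun ω => k + Z ω) ξ = k + ϱ t Z ξ :=
  hcoh.translation t ht Z hZ (fun _ => k) (BddFunctional.const k) ξ

theorem IsMarkovian.risk_cost_eq_value (hmarkov : IsMarkovian T ϱ) {c : ℝ → X → ℝ}
    (hc : EssBddRate 0 T c) (f : X → ℝ) {t : ℝ} (ht : t ∈ Icc 0 T) (ξ : Traj X) :
    ϱ t (cost T c f t) ξ = value T ϱ c f t (ξ t) :=
  hmarkov t ht ξ (Traj.const (ξ t)) rfl c f (hc.mono (Icc_subset_Icc_left ht.1))

variable [Fintype X]

theorem IsCoherent.value_terminal (hcoh : IsCoherent T ϱ) (hT : 0 ≤ T) (c : ℝ → X → ℝ)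
    (f : X → ℝ) (x : X) : value T ϱ c f T x = f x := by
  have h : cost T c f T = fun ω : Traj X => f (ω T) := by
    ext ω
    simp [cost]
  rw [value, h, hcoh.risk_of_mem ⟨hT, le_rfl⟩ (BddFunctional.state ⟨hT, le_rfl⟩ f)]
  rfl

theorem IsCoherent.value_bounded (hcoh : IsCoherent T ϱ) {c : ℝ → X → ℝ}
    (hc : EssBddRate 0 T c) (f : X → ℝ) :
    ∃ V : ℝ, 0 ≤ V ∧ ∀ t ∈ Icc 0 T, ∀ x, |value T ϱ c f t x| ≤ V := by
  obtain ⟨C, hC0, hC⟩ := hc.exists_bound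
  have hF0 : 0 ≤ ∑ x, |f x| := Finset.sum_nonneg fun _ _ => abs_nonneg _
  refine ⟨C * |T| + ∑ x, |f x|, by positivity, fun t ht x => ?_⟩
  have hcost : ∀ ω : Traj X, |cost T c f t ω| ≤ C * |T| + ∑ x, |f x| := fun ω => by
    have h1 := abs_integral_rate_path_le ω ht.2
      (ae_restrict_of_ae_restrict_of_subset (Icc_subset_Icc_left ht.1) hC)
    have h2 := Finset.single_le_sum (f := fun x => |f x|) (fun _ _ => abs_nonneg _)
      (Finset.mem_univ (ω T))
    have h3 : C * (T - t) ≤ C * |T| := by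
      gcongr
      linarith [le_abs_self T, ht.1]
    exact (abs_add_le _ _).trans (add_le_add (h1.trans h3) h2)
  have hmem : cost T c f t ∈ BddFunctional 0 T :=
    BddFunctional.mono (Icc_subset_Icc_left ht.1)
      (BddFunctional.cost ht.2 (hc.mono (Icc_subset_Icc_left ht.1)) f)
  have hconst : ∀ k : ℝ, ϱ t (fun _ => k) (Traj.const x) = k := fun k =>
    hcoh.risk_of_mem ht (BddFunctional.const k) _
  rw [abs_le]
  constructor
  · have h := hcoh.monotonic t ht _ (BddFunctional.const (-(C * |T| + ∑ x, |f x|))) _ hmem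
      (fun ω => (abs_le.1 (hcost ω)).1) (Traj.const x)
    rwa [hconst] at h
  · have h := hcoh.monotonic t ht _ hmem _ (BddFunctional.const (C * |T| + ∑ x, |f x|))
      (fun ω => (abs_le.1 (hcost ω)).2) (Traj.const x)
    rwa [hconst] at h

variable [DecidableEq X] {𝒳 : Chain X T}

/-- The dynamic programming equation. -/
theorem StronglyTimeConsistent.value_eq (hcons : StronglyTimeConsistent 𝒳 ϱ)
    (hcoh : IsCoherent T ϱ) (hmarkov : IsMarkovian T ϱ) {c : ℝ → X → ℝ} (hc : EssBddRate 0 T c)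
    (f : X → ℝ) {t r : ℝ} (ht : 0 ≤ t) (htr : t ≤ r) (hr : r ≤ T) (x : X) :
    value T ϱ c f t x = ϱ t ((fun ω => ∫ s in t..r, c s (ω s)) +
      fun ω => value T ϱ c f r (ω r)) (Traj.const x) := by
  have htT : t ∈ Icc 0 T := ⟨ht, htr.trans hr⟩
  have hrT : r ∈ Icc 0 T := ⟨ht.trans htr, hr⟩
  have hI : (fun ω : Traj X => ∫ s in t..r, c s (ω s)) ∈ BddFunctional 0 r :=
    BddFunctional.mono (Icc_subset_Icc_left ht)
      (BddFunctional.integral htr (hc.mono (Icc_subset_Icc ht hr)))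
  have hW : (fun ω : Traj X => ∫ s in t..r, c s (ω s)) +
      (fun ω => value T ϱ c f r (ω r)) ∈ BddFunctional 0 r :=
    BddFunctional.add hI (BddFunctional.state ⟨hrT.1, le_rfl⟩ _)
  have hcost : ∀ {t}, t ∈ Icc 0 T → cost T c f t ∈ BddFunctional 0 T := fun ht =>
    BddFunctional.mono (Icc_subset_Icc_left ht.1)
      (BddFunctional.cost ht.2 (hc.mono (Icc_subset_Icc_left ht.1)) f)
  have heq : ∀ ξ, ϱ r (cost T c f t) ξ = ϱ r ((fun ω => ∫ s in t..r, c s (ω s)) +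
      fun ω => value T ϱ c f r (ω r)) ξ := fun ξ => by
    rw [cost_eq_integral_add htr hr (hc.mono (Icc_subset_Icc_left ht)) f,
      hcoh.translation r hrT _ (hcost hrT) _ hI, hmarkov.risk_cost_eq_value hc f hrT,
      hcoh.risk_of_mem hrT hW]
    rfl
  have hWT := BddFunctional.mono (Icc_subset_Icc_right hr) hW
  -- The two functionals have the same risk at time `r` for every history, so the tail probabilities
  -- agree and time consistency applies both ways.
  refine le_antisymm ?_ ?_
  · exact hcons t htT r ⟨htr, hr⟩ r ⟨htr, hr⟩ _ _ (hcost htT) _ hWT fun η => by simp [heq]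
  · exact hcons t htT r ⟨htr, hr⟩ r ⟨htr, hr⟩ _ _ hWT _ (hcost htT) fun η => by simp [heq]

/-- `h(X_r)` differs from the constant `h x`, by at most `2 * V`, only if the chain is away from `x`
at `r`. The order `(r - t)^(1/p)` is enough for continuity of the value function. -/
theorem abs_risk_state_sub_le (hcoh : IsCoherent T ϱ) {p L g V : ℝ} (hp : 1 ≤ p) (hL : 0 ≤ L)
    (hlip : ∀ t ∈ Icc 0 T, ∀ r ∈ Icc t T, ∀ ξ : Traj X,
      ∀ Y ∈ BddFunctional t r, ∀ Y' ∈ BddFunctional t r,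
        |ϱ t Y ξ - ϱ t Y' ξ| ≤ L * (∫ ω, |Y ω - Y' ω| ^ p ∂(𝒳.law t (ξ t))) ^ (1 / p))
    (hg : ∀ t ∈ Ico 0 T, ∀ x y, |𝒳.G t x y| ≤ g) (hV : 0 ≤ V) {h : X → ℝ}
    (hh : ∀ x, |h x| ≤ V) {t r : ℝ} (ht : 0 ≤ t) (htr : t ≤ r) (hr : r ≤ T) (x : X) :
    |ϱ t (fun ω => h (ω r)) (Traj.const x) - h x| ≤
      L * (2 * V * (g * (r - t)) ^ (1 / p)) := by
  have htT : t ∈ Icc 0 T := ⟨ht, htr.trans hr⟩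
  have := 𝒳.law_prob t htT x
  have h0 : ϱ t (fun _ => h x) (Traj.const x) = h x :=
    hcoh.risk_of_mem htT (BddFunctional.const _) _
  have hlipx : ∀ Y ∈ BddFunctional t r, ∀ Y' ∈ BddFunctional t r,
      |ϱ t Y (Traj.const x) - ϱ t Y' (Traj.const x)| ≤
        L * (∫ ω, |Y ω - Y' ω| ^ p ∂(𝒳.law t x)) ^ (1 / p) :=
    hlip t htT r ⟨htr, hr⟩ (Traj.const x)
  have h1 := hlipx _ (BddFunctional.state ⟨htr, le_rfl⟩ h) _
    (BddFunctional.const (h x))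
  rw [h0] at h1
  refine h1.trans (mul_le_mul_of_nonneg_left ?_ hL)
  have hset : MeasurableSet {ω : Traj X | ω r ≠ x} := measurableSet_state r {x}ᶜ
  refine rpow_integral_rpow_le (B := {ω : Traj X | ω r ≠ x}.indicator 1) hp (by positivity)
    (fun ω => indicator_nonneg (fun _ _ => zero_le_one) ω)
    (fun ω => indicator_le_self' (fun _ _ => zero_le_one) ω) (fun ω => ?_)
    ((integrable_const (1 : ℝ)).indicator hset) ?_
  · by_cases hω : ω r = x
    · simp [hω]
    · rw [indicator_of_mem (show ω ∈ {ω : Traj X | ω r ≠ x} from hω)]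
      have h2 := abs_sub (h (ω r)) (h x)
      simp only [Pi.one_apply, mul_one]
      linarith [hh (ω r), hh x]
  · have h2 : ∫ ω : Traj X, {ω : Traj X | ω r ≠ x}.indicator 1 ω ∂𝒳.law t x =
        (𝒳.law t x).real {ω | ω r ≠ x} := integral_indicator_one hset
    rw [h2]
    exact (𝒳.law_ne_le ht htr hr x).trans (𝒳.one_sub_Q_le hg ht htr hr x)

/-- Freezing the running cost at `x` changes it only during the time spent away from `x`. The length
of the interval supplies a full factor `r - t` besides `(g (r - t))^(1/p)`, so the error is `o(r -
t)`. -/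
theorem abs_value_sub_risk_le (hcons : StronglyTimeConsistent 𝒳 ϱ) (hcoh : IsCoherent T ϱ)
    (hmarkov : IsMarkovian T ϱ) {p L g C : ℝ} (hp : 1 ≤ p) (hL : 0 ≤ L)
    (hlip : ∀ t ∈ Icc 0 T, ∀ r ∈ Icc t T, ∀ ξ : Traj X,
      ∀ Y ∈ BddFunctional t r, ∀ Y' ∈ BddFunctional t r,
        |ϱ t Y ξ - ϱ t Y' ξ| ≤ L * (∫ ω, |Y ω - Y' ω| ^ p ∂(𝒳.law t (ξ t))) ^ (1 / p))
    (hg : ∀ t ∈ Ico 0 T, ∀ x y, |𝒳.G t x y| ≤ g) {c : ℝ → X → ℝ} (hc : EssBddRate 0 T c)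
    (hC0 : 0 ≤ C) (hC : ∀ᵐ s ∂volume.restrict (Icc 0 T), ∀ x, |c s x| ≤ C) (f : X → ℝ) {t r : ℝ}
    (ht : 0 ≤ t) (htr : t < r) (hr : r ≤ T) (x : X) :
    |value T ϱ c f t x - (∫ s in t..r, c s x) -
        ϱ t (fun ω => value T ϱ c f r (ω r)) (Traj.const x)| ≤
      L * (2 * C * (r - t) * (g * (r - t)) ^ (1 / p)) := by
  have htT : t ∈ Icc 0 T := ⟨ht, htr.le.trans hr⟩
  have hrt : 0 < r - t := sub_pos.2 htr
  have := 𝒳.law_prob t htT x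
  have hctr : EssBddRate t r c := hc.mono (Icc_subset_Icc ht hr)
  have hCtr := ae_restrict_of_ae_restrict_of_subset (Icc_subset_Icc ht hr) hC
  have hv : (fun ω : Traj X => value T ϱ c f r (ω r)) ∈ BddFunctional t r :=
    BddFunctional.state ⟨htr.le, le_rfl⟩ _
  have h0 := hcoh.risk_const_add htT (∫ s in t..r, c s x)
    (BddFunctional.mono (Icc_subset_Icc ht hr) hv) (Traj.const x)
  have hlipx : ∀ Y ∈ BddFunctional t r, ∀ Y' ∈ BddFunctional t r,
      |ϱ t Y (Traj.const x) - ϱ t Y' (Traj.const x)| ≤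
        L * (∫ ω, |Y ω - Y' ω| ^ p ∂(𝒳.law t x)) ^ (1 / p) :=
    hlip t htT r ⟨htr.le, hr⟩ (Traj.const x)
  have h1 := hlipx _
    (BddFunctional.add (BddFunctional.integral htr.le hctr) hv) _
    (BddFunctional.add (BddFunctional.const (∫ s in t..r, c s x)) hv)
  rw [← hcons.value_eq hcoh hmarkov hc f ht htr.le hr x] at h1
  rw [sub_sub, ← h0]
  refine h1.trans (mul_le_mul_of_nonneg_left ?_ hL)
  -- `A` is the time spent away from `x`; `A / (r - t)` takes values in `[0, 1]`.
  set A : Traj X → ℝ := fun ω => ∫ s in t..r, if ω s = x then (0 : ℝ) else 1 with hA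
  have hrate : EssBddRate t r fun (_ : ℝ) y => if y = x then (0 : ℝ) else 1 := fun y =>
    memLp_const _
  have hAmem : A ∈ BddFunctional t r := BddFunctional.integral htr.le hrate
  have hAi : ∀ ω : Traj X, IntervalIntegrable (fun s => if ω s = x then (0 : ℝ) else 1)
      volume t r := fun ω => intervalIntegrable_rate_path ω.eventually_eq htr.le hrate
  have hA0 : ∀ ω, 0 ≤ A ω := fun ω => intervalIntegral.integral_nonneg htr.le fun s _ => by
    split_ifs <;> simp
  have hA1 : ∀ ω, A ω ≤ r - t := fun ω => by
    have h := intervalIntegral.integral_mono_on htr.le (hAi ω)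
      (intervalIntegrable_const (c := (1 : ℝ))) fun s _ => by split_ifs <;> simp
    simpa using h
  have hDA : ∀ ω : Traj X, |(∫ s in t..r, c s (ω s)) - ∫ s in t..r, c s x| ≤ 2 * C * A ω := by
    intro ω
    have h := intervalIntegral.integral_sub (f := fun s => c s (ω s)) (g := fun s => c s x)
      (intervalIntegrable_rate_path ω.eventually_eq htr.le hctr)
      (intervalIntegrable_rate_path (y := fun _ => x) (fun _ => Eventually.of_forall fun _ => rfl)
        htr.le hctr)
    rw [← h, hA, ← intervalIntegral.integral_const_mul]
    refine intervalIntegral.norm_integral_le_of_norm_le (f := fun s => c s (ω s) - c s x) htr.le ?_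
      ((hAi ω).const_mul _)
    rw [← ae_restrict_iff' measurableSet_Ioc]
    filter_upwards [ae_restrict_of_ae_restrict_of_subset Ioc_subset_Icc_self hCtr] with s hs
    by_cases hω : ω s = x
    · simp [hω]
    · simp only [hω, if_false, mul_one]
      have h2 := abs_sub (c s (ω s)) (c s x)
      rw [Real.norm_eq_abs]
      linarith [hs (ω s), hs x]
  have hAint : Integrable A (𝒳.law t x) := by
    refine Integrable.of_bound (C := r - t) (hAmem.1.mono (hist_le _ _) le_rfl).aestronglyMeasurable
      (Eventually.of_forall fun ω => ?_)
    rw [Real.norm_of_nonneg (hA0 ω)]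
    exact hA1 ω
  refine rpow_integral_rpow_le (B := fun ω => A ω / (r - t)) hp (by positivity)
    (fun ω => div_nonneg (hA0 ω) hrt.le) (fun ω => (div_le_one hrt).2 (hA1 ω)) (fun ω => ?_)
    (hAint.div_const _) ?_
  · have h2 : 2 * C * (r - t) * (A ω / (r - t)) = 2 * C * A ω := by field_simp
    rw [h2]
    simpa only [Pi.add_apply, add_sub_add_right_eq_sub] using hDA ω
  · rw [integral_div, div_le_iff₀ hrt]
    refine integral_away_le htr.le x fun s hs => ?_
    refine (𝒳.law_ne_le ht hs.1 (hs.2.trans hr) x).trans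
      ((𝒳.one_sub_Q_le hg ht hs.1 (hs.2.trans hr) x).trans ?_)
    have hg0 : 0 ≤ g := (abs_nonneg _).trans (hg t ⟨ht, htr.trans_le hr⟩ x x)
    gcongr
    exact hs.2

theorem continuousOn_value_and_tendsto_slope (hcons : StronglyTimeConsistent 𝒳 ϱ) (hcoh : IsCoherent T ϱ)
    (hmarkov : IsMarkovian T ϱ) (hlip : LipschitzInLp 𝒳 ϱ) {c : ℝ → X → ℝ}
    (hc : EssBddRate 0 T c) (f : X → ℝ) (x : X) :
    ContinuousOn (fun t => value T ϱ c f t x) (Icc 0 T) ∧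
    ∀ t ∈ Ico 0 T, Tendsto (fun r => (r - t)⁻¹ * (value T ϱ c f t x - (∫ s in t..r, c s x) -
        ϱ t (fun ω => value T ϱ c f r (ω r)) (Traj.const x))) (𝓝[>] t) (𝓝 0) := by
  obtain ⟨p, L', hp, hlip'⟩ := hlip
  -- The sign of the given Lipschitz constant is not known.
  set L := |L'|
  have hL : 0 ≤ L := abs_nonneg _
  have hlip : ∀ t ∈ Icc 0 T, ∀ r ∈ Icc t T, ∀ ξ : Traj X,
      ∀ Y ∈ BddFunctional t r, ∀ Y' ∈ BddFunctional t r,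
        |ϱ t Y ξ - ϱ t Y' ξ| ≤ L * (∫ ω, |Y ω - Y' ω| ^ p ∂(𝒳.law t (ξ t))) ^ (1 / p) :=
    fun t ht r hr ξ Y hY Y' hY' => (hlip' t ht r hr ξ Y hY Y' hY').trans
      (mul_le_mul_of_nonneg_right (le_abs_self _)
        (Real.rpow_nonneg (integral_nonneg fun ω => by positivity) _))
  obtain ⟨g, hg⟩ := 𝒳.G_bdd
  obtain ⟨C, hC0, hC⟩ := hc.exists_bound
  obtain ⟨V, hV0, hV⟩ := hcoh.value_bounded hc f
  have hp' : 0 < 1 / p := by positivity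
  have hψ : Tendsto (fun d : ℝ => (g * d) ^ (1 / p)) (𝓝 0) (𝓝 0) := by
    have h : Continuous fun d : ℝ => (g * d) ^ (1 / p) :=
      (continuous_const.mul continuous_id).rpow_const fun _ => Or.inr hp'.le
    simpa [-one_div, Real.zero_rpow hp'.ne'] using h.tendsto 0
  constructor
  -- The terms bound the frozen running cost, the error of freezing it, and the risk of `v_r(X_r)`
  -- relative to `v_r(x)`. The bound depends only on `r - t`, so it gives continuity from both
  -- sides.
  · set m : ℝ → ℝ := fun d => C * d + L * (2 * C * d * (g * d) ^ (1 / p)) +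
      L * (2 * V * (g * d) ^ (1 / p)) with hm
    have hm0 : Tendsto m (𝓝 0) (𝓝 0) := by
      have h := ((tendsto_id (α := ℝ)).const_mul C).add
        ((((tendsto_id (α := ℝ) (x := 𝓝 0)).const_mul (2 * C)).mul hψ).const_mul L) |>.add
        ((hψ.const_mul (2 * V)).const_mul L)
      simpa [-one_div] using h
    have hinc : ∀ t r, 0 ≤ t → t ≤ r → r ≤ T →
        |value T ϱ c f t x - value T ϱ c f r x| ≤ m (r - t) := by
      intro t r ht htr hr
      rcases htr.eq_or_lt with rfl | htr
      · simp [-one_div, hm, Real.zero_rpow hp'.ne']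
      · have h1 := abs_value_sub_risk_le hcons hcoh hmarkov hp hL hlip hg hc hC0 hC f ht htr hr x
        have h2 := abs_risk_state_sub_le hcoh hp hL hlip hg hV0
          (hV r ⟨ht.trans htr.le, hr⟩) ht htr.le hr x
        have h3 := abs_integral_rate_path_le (fun _ => x) htr.le
          (ae_restrict_of_ae_restrict_of_subset (Icc_subset_Icc ht hr) hC)
        rw [abs_le] at h1 h2 h3 ⊢
        simp only [hm]
        constructor <;> linarith [h1.1, h1.2, h2.1, h2.2, h3.1, h3.2]
    intro t ht
    have hd : Tendsto (fun r => |r - t|) (𝓝[Icc 0 T] t) (𝓝 0) := by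
      have h : Continuous fun r : ℝ => |r - t| := by fun_prop
      simpa using (h.tendsto t).mono_left (nhdsWithin_le_nhds (s := Icc 0 T))
    refine tendsto_iff_dist_tendsto_zero.2 ?_
    refine squeeze_zero' (Eventually.of_forall fun _ => dist_nonneg) ?_ (hm0.comp hd)
    filter_upwards [self_mem_nhdsWithin] with r hr
    rw [Real.dist_eq]
    rcases le_total t r with h | h
    · rw [abs_sub_comm]
      simpa [abs_of_nonneg (sub_nonneg.2 h)] using hinc t r ht.1 h hr.2
    · simpa [abs_of_nonpos (sub_nonpos.2 h)] using hinc r t hr.1 h ht.2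
  · intro t ht
    have hd : Tendsto (fun r => r - t) (𝓝[>] t) (𝓝 0) := by
      have h : Continuous fun r : ℝ => r - t := by fun_prop
      simpa using (h.tendsto t).mono_left (nhdsWithin_le_nhds (s := Ioi t))
    have hb : Tendsto (fun r => L * (2 * C * (g * (r - t)) ^ (1 / p))) (𝓝[>] t) (𝓝 0) := by
      simpa [-one_div] using ((hψ.comp hd).const_mul (2 * C)).const_mul L
    refine squeeze_zero_norm' ?_ hb
    filter_upwards [Ioo_mem_nhdsGT ht.2] with r hr
    have hrt : 0 < r - t := sub_pos.2 hr.1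
    have h1 := abs_value_sub_risk_le hcons hcoh hmarkov hp hL hlip hg hc hC0 hC f ht.1 hr.1
      hr.2.le x
    rw [norm_mul, norm_inv, Real.norm_of_nonneg hrt.le, inv_mul_le_iff₀ hrt, Real.norm_eq_abs]
    linarith

end RiskMeasure

section

variable {X : Type*} [Fintype X]

/-! ### Dual representation of coherent mappings -/

/-- Hahn-Banach: the functional `a • v ↦ a * σ(v)` on the line through `v` is dominated by the
sublinear `σ`, and so is some linear extension. Monotonicity makes the extension positive,
translation gives it mass one. -/
theorem IsCoherentMapping.exists_mem_dualSet {T : ℝ} {σ : ℝ → X → (X → ℝ) → (X → ℝ) → ℝ}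
    (h : IsCoherentMapping T σ) {t : ℝ} (ht : t ∈ Icc 0 T) (x : X) {m : X → ℝ}
    (hm : m ∈ stdSimplex ℝ X) (v : X → ℝ) :
    ∃ μ ∈ dualSet (σ t) x m, ∑ y, v y * μ y = σ t x m v := by
  classical
  have hhom := h.homogeneous t ht x m hm
  have hadd : ∀ u w, σ t x m (u + w) ≤ σ t x m u + σ t x m w := fun u w => by
    have h1 := h.convex t ht x m hm u w (1 / 2) ⟨by norm_num, by norm_num⟩
    have h2 := hhom ((1 / 2 : ℝ) • u + (1 - 1 / 2 : ℝ) • w) 2 (by norm_num)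
    have h3 : (2 : ℝ) • ((1 / 2 : ℝ) • u + (1 - 1 / 2 : ℝ) • w) = u + w := by
      ext y
      simp
      ring
    rw [h3] at h2
    linarith
  have h0 : σ t x m 0 = 0 := by simpa using hhom 0 0 le_rfl
  have hone : ∀ a : ℝ, σ t x m (fun _ => a) = a := fun a => by
    have h1 := h.translation t ht x m hm 0 a
    simp only [Pi.zero_apply, add_zero] at h1
    rw [h1, h0, add_zero]
  have hwd : ∀ a : ℝ, a • v = 0 → a • σ t x m v = 0 := fun a ha => by
    rcases smul_eq_zero.1 ha with ha | hv
    · simp [ha]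
    · simp [hv, h0]
  set F : (X → ℝ) →ₗ.[ℝ] ℝ := LinearPMap.mkSpanSingleton' v (σ t x m v) hwd
  have hF : ∀ (a : ℝ) (ha : a • v ∈ F.domain), F ⟨a • v, ha⟩ = a * σ t x m v := fun a ha =>
    LinearPMap.mkSpanSingleton'_apply v (σ t x m v) hwd a ha
  obtain ⟨φ, hφ1, hφ2⟩ := exists_extension_of_le_sublinear F (σ t x m)
    (fun a ha u => hhom u a ha.le) hadd (by
      rintro ⟨u, hu⟩
      obtain ⟨a, rfl⟩ := Submodule.mem_span_singleton.1 hu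
      rw [hF]
      -- For `a ≤ 0`, sublinearity gives `0 = σ(0) ≤ σ(a • v) + (-a) * σ(v)`.
      rcases le_total 0 a with ha | ha
      · exact (hhom v a ha).ge
      · have h1 := hadd (a • v) ((-a) • v)
        rw [← add_smul, add_neg_cancel, zero_smul, h0, hhom v (-a) (by linarith)] at h1
        linarith)
  have hφsum : ∀ w : X → ℝ, φ w = ∑ y, w y * φ (Pi.single y 1) := fun w => by
    conv_lhs => rw [pi_eq_sum_univ' w]
    rw [map_sum]
    refine Finset.sum_congr rfl fun y _ => ?_
    rw [map_smul, smul_eq_mul]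
  have hφv : φ v = σ t x m v := by
    have h1 : (1 : ℝ) • v ∈ F.domain :=
      Submodule.smul_mem _ _ (Submodule.mem_span_singleton_self v)
    have h2 := hφ1 ⟨(1 : ℝ) • v, h1⟩
    rw [hF] at h2
    simpa using h2
  refine ⟨fun y => φ (Pi.single y 1), ⟨⟨fun y => ?_, ?_⟩, fun w => ?_⟩, ?_⟩
  · have h1 := hφ2 (-Pi.single y 1)
    have h2 := h.monotonic t ht x m hm (-Pi.single y 1) 0 fun z => by
      by_cases hz : z = y <;> simp [hz]
    rw [map_neg] at h1
    rw [h0] at h2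
    linarith
  -- Domination at the constants `1` and `-1` pins the mass from both sides.
  · have h1 := hφsum fun _ => 1
    have h2 := hφ2 fun _ => 1
    have h3 := hφ2 (-fun _ => 1)
    have h4 : (-fun _ => 1 : X → ℝ) = fun _ => -1 := rfl
    rw [map_neg, h4, hone] at h3
    rw [hone] at h2
    simp only [one_mul] at h1
    linarith
  · exact (hφsum w).symm.trans_le (hφ2 w)
  · rw [← hφsum v, hφv]

/-- The constraints on a multikernel are row by row, so maximisers chosen separately for each state
form one kernel. -/
theorem IsCoherentMapping.exists_mem_multikernel {T : ℝ} {σ : ℝ → X → (X → ℝ) → (X → ℝ) → ℝ}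
    (h : IsCoherentMapping T σ) {t : ℝ} (ht : t ∈ Icc 0 T) {Q : X → X → ℝ}
    (hQ : Q ∈ stochasticKernels X) (v : X → ℝ) :
    ∃ M ∈ multikernel (σ t) Q, ∀ x, ∑ y, v y * M x y = σ t x (Q x) v := by
  choose M hM hMv using fun x => h.exists_mem_dualSet ht x (hQ x) v
  exact ⟨M, ⟨fun x => (hM x).1, hM⟩, hMv⟩

/-! ### Support functions and distances -/

theorem abs_sum_mul_le (l w : X → ℝ) : |∑ y, l y * w y| ≤ (∑ y, |l y|) * ‖w‖ := by
  rw [Finset.sum_mul]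
  refine (Finset.abs_sum_le_sum_abs _ _).trans (Finset.sum_le_sum fun y _ => ?_)
  rw [abs_mul]
  exact mul_le_mul_of_nonneg_left (norm_le_pi_norm w y) (abs_nonneg _)

/-- The bound on `A` matters: the real `sSup` of a set unbounded above is zero. -/
theorem sum_mul_le_supportFn {A : Set (X → ℝ)} {C : ℝ} (hA : ∀ l ∈ A, ∑ y, |l y| ≤ C)
    {l : X → ℝ} (hl : l ∈ A) (v : X → ℝ) : ∑ y, l y * v y ≤ supportFn A v := by
  refine le_csSup ⟨C * ‖v‖, ?_⟩ ⟨l, hl, rfl⟩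
  rintro _ ⟨l, hl, rfl⟩
  exact (le_abs_self _).trans ((abs_sum_mul_le l v).trans
    (mul_le_mul_of_nonneg_right (hA l hl) (norm_nonneg _)))

theorem supportFn_le {A : Set (X → ℝ)} (hA : A.Nonempty) {v : X → ℝ} {b : ℝ}
    (h : ∀ l ∈ A, ∑ y, l y * v y ≤ b) : supportFn A v ≤ b :=
  csSup_le (hA.image _) (by rintro _ ⟨l, hl, rfl⟩; exact h l hl)

theorem supportFn_sub_le {A : Set (X → ℝ)} (hA : A.Nonempty) {C : ℝ}
    (hAC : ∀ l ∈ A, ∑ y, |l y| ≤ C) (v w : X → ℝ) :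
    supportFn A v - supportFn A w ≤ C * ‖v - w‖ := by
  rw [sub_le_iff_le_add]
  refine supportFn_le hA fun l hl => ?_
  have h1 := (le_abs_self _).trans ((abs_sum_mul_le l (v - w)).trans
    (mul_le_mul_of_nonneg_right (hAC l hl) (norm_nonneg _)))
  have h2 := sum_mul_le_supportFn hAC hl w
  simp only [Pi.sub_apply, mul_sub, Finset.sum_sub_distrib] at h1
  linarith

theorem abs_supportFn_sub_le {A : Set (X → ℝ)} (hA : A.Nonempty) {C : ℝ}
    (hAC : ∀ l ∈ A, ∑ y, |l y| ≤ C) (v w : X → ℝ) :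
    |supportFn A v - supportFn A w| ≤ C * ‖v - w‖ := by
  rw [abs_le]
  have h1 := supportFn_sub_le hA hAC v w
  have h2 := supportFn_sub_le hA hAC w v
  rw [norm_sub_rev] at h2
  exact ⟨by linarith, h1⟩

theorem abs_supportFn_le {A : Set (X → ℝ)} (hA : A.Nonempty) {C : ℝ}
    (hAC : ∀ l ∈ A, ∑ y, |l y| ≤ C) (v : X → ℝ) : |supportFn A v| ≤ C * ‖v‖ := by
  have h := abs_supportFn_sub_le hA hAC v 0
  have h0 : supportFn A (0 : X → ℝ) = 0 := by
    refine le_antisymm (supportFn_le hA fun l _ => by simp) ?_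
    obtain ⟨l, hl⟩ := hA
    simpa using sum_mul_le_supportFn hAC hl 0
  rwa [h0, sub_zero, sub_zero] at h

theorem sum_abs_le_kernelNorm (K : X → X → ℝ) (x : X) : ∑ y, |K x y| ≤ kernelNorm K :=
  le_ciSup (f := fun x => ∑ y, |K x y|) (finite_range _).bddAbove x

theorem exists_kernelNorm_lt_of_distToSet_lt {K : X → X → ℝ} {B : Set (X → X → ℝ)} {δ : ℝ}
    (hδ : 0 < δ) (h : distToSet K B < ENNReal.ofReal δ) : ∃ M ∈ B, kernelNorm (K - M) < δ := by
  simp only [distToSet, iInf_lt_iff] at h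
  obtain ⟨M, hM, h⟩ := h
  exact ⟨M, hM, (ENNReal.ofReal_lt_ofReal_iff hδ).1 h⟩

theorem distToSet_le_hausdorff_left {S₁ S₂ : Set (X → X → ℝ)} {K : X → X → ℝ} (hK : K ∈ S₁) :
    distToSet K S₂ ≤ hausdorff S₁ S₂ :=
  (le_iSup₂ (f := fun K (_ : K ∈ S₁) => distToSet K S₂) K hK).trans (le_max_left _ _)

theorem distToSet_le_hausdorff_right {S₁ S₂ : Set (X → X → ℝ)} {K : X → X → ℝ} (hK : K ∈ S₂) :
    distToSet K S₁ ≤ hausdorff S₁ S₂ :=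
  (le_iSup₂ (f := fun K (_ : K ∈ S₂) => distToSet K S₁) K hK).trans (le_max_right _ _)

theorem kernelNorm_zero : kernelNorm (0 : X → X → ℝ) = 0 := by
  simp [kernelNorm]

theorem tendsto_kernelNorm_zero {ι : Type*} {l : Filter ι} {k : ι → X → X → ℝ}
    (h : ∀ x y, Tendsto (fun i => k i x y) l (𝓝 0)) :
    Tendsto (fun i => kernelNorm (k i)) l (𝓝 0) := by
  have hb : Tendsto (fun i => ∑ x, ∑ y, |k i x y|) l (𝓝 0) := by
    have := tendsto_finsetSum Finset.univ fun x _ =>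
      tendsto_finsetSum Finset.univ fun y _ => (h x y).abs
    simpa using this
  have h0 : ∀ (K : X → X → ℝ) x, 0 ≤ ∑ y, |K x y| := fun K x =>
    Finset.sum_nonneg fun _ _ => abs_nonneg _
  refine squeeze_zero (fun i => Real.iSup_nonneg (h0 _)) (fun i => ?_) hb
  exact Real.iSup_le (fun x => Finset.single_le_sum (f := fun x => ∑ y, |k i x y|)
    (fun x _ => h0 _ x) (Finset.mem_univ x)) (Finset.sum_nonneg fun x _ => h0 _ x)

variable [DecidableEq X]

theorem idKernel_mem_stochasticKernels : idKernel X ∈ stochasticKernels X := fun x =>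
  ⟨fun y => by simp only [idKernel]; split_ifs <;> simp, by simp [idKernel]⟩

/-- By convexity the segment from the identity to `Q` consists of stochastic kernels, so for `τ < ε`
the direction lies in the quotient set itself and its distance is zero. -/
theorem inv_smul_sub_idKernel_mem_tangentConeId {ε : ℝ} (hε : 0 < ε) {Q : X → X → ℝ}
    (hQ : Q ∈ stochasticKernels X) : ε⁻¹ • (Q - idKernel X) ∈ tangentConeId X := by
  refine tendsto_const_nhds.congr' ?_
  filter_upwards [Ioo_mem_nhdsGT hε] with τ hτ
  have hmem : ε⁻¹ • (Q - idKernel X) ∈ quotientSet τ (stochasticKernels X) := by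
    refine ⟨(1 - τ / ε) • idKernel X + (τ / ε) • Q, fun x => ?_, ?_⟩
    · exact convex_stdSimplex ℝ X (idKernel_mem_stochasticKernels x) (hQ x)
        (sub_nonneg.2 ((div_le_one hε).2 hτ.2.le)) (div_nonneg hτ.1.le hε.le) (by ring)
    · have hτ0 := hτ.1.ne'
      ext x y
      simp only [Pi.smul_apply, Pi.sub_apply, Pi.add_apply, smul_eq_mul]
      field_simp
      ring
  refine (nonpos_iff_eq_zero.1 ?_).symm
  refine (iInf₂_le _ hmem).trans ?_
  rw [sub_self, kernelNorm_zero, ENNReal.ofReal_zero]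

/-- The directions are the difference quotients of `Q`: they are tangent, converge to the rates, and
reproduce `Q t r` exactly. -/
theorem IsSemiDerivative.tendsto_hausdorff {T : ℝ} {𝒳 : Chain X T}
    {M : (X → X → ℝ) → Set (X → X → ℝ)} {t : ℝ} (ht : t ∈ Ico 0 T) {D : Set (X → X → ℝ)}
    (h : IsSemiDerivative M (𝒳.G t) D) :
    Tendsto (fun r => hausdorff (quotientSet (r - t) (M (𝒳.Q t r))) D) (𝓝[>] t) (𝓝 0) := by
  refine tendsto_of_seq_tendsto fun r hr => ?_
  obtain ⟨N, hN⟩ := eventually_atTop.1 (hr.eventually (Ioo_mem_nhdsGT ht.2))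
  -- Semi-differentiability wants positive steps for all indices, so the initial terms are dropped.
  rw [← tendsto_add_atTop_iff_nat N]
  have hrN : ∀ n, r (n + N) ∈ Ioo t T := fun n => hN _ (Nat.le_add_left _ _)
  have hε : ∀ n, 0 < r (n + N) - t := fun n => sub_pos.2 (hrN n).1
  have hε0 : Tendsto (fun n => r (n + N) - t) atTop (𝓝 0) := by
    have h1 := (tendsto_nhdsWithin_iff.1 hr).1.comp (tendsto_add_atTop_nat N)
    simpa using h1.sub_const t
  have hQ : ∀ n, 𝒳.Q t (r (n + N)) ∈ stochasticKernels X := fun n x =>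
    𝒳.Q_mem t _ ht.1 (hrN n).1.le (hrN n).2.le x
  have h1 := h.2 (fun n => r (n + N) - t)
    (fun n => (r (n + N) - t)⁻¹ • (𝒳.Q t (r (n + N)) - idKernel X)) hε hε0
    (fun n => inv_smul_sub_idKernel_mem_tangentConeId (hε n) (hQ n)) ?_
  · refine h1.congr fun n => ?_
    rw [smul_inv_smul₀ (hε n).ne', add_sub_cancel]
    rfl
  · refine tendsto_kernelNorm_zero fun x y => ?_
    have h2 := (𝒳.G_lim t ht x y).comp (tendsto_nhdsWithin_iff.2 ⟨hε0, Eventually.of_forall hε⟩)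
    have h3 := h2.sub_const (𝒳.G t x y)
    rw [sub_self] at h3
    refine h3.congr fun n => ?_
    simp [idKernel]

/-- The risk of the transition has the support function of the multigenerator as right derivative. -/
theorem tendsto_transitionRisk_slope {T : ℝ} {𝒳 : Chain X T}
    {σ : ℝ → X → (X → ℝ) → (X → ℝ) → ℝ} (hσ : IsCoherentMapping T σ) {t : ℝ} (ht : t ∈ Ico 0 T)
    {D : Set (X → X → ℝ)} (hD : IsSemiDerivative (multikernel (σ t)) (𝒳.G t) D) {C : ℝ}
    {x : X} (hC : ∀ l ∈ multigenerator D x, ∑ y, |l y| ≤ C) {w : ℝ → X → ℝ}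
    (hw : Tendsto w (𝓝[>] t) (𝓝 (w t))) :
    Tendsto (fun r => (r - t)⁻¹ * (σ t x (𝒳.Q t r x) (w r) - w r x)) (𝓝[>] t)
      (𝓝 (supportFn (multigenerator D x) (w t))) := by
  have hH := hD.tendsto_hausdorff ht
  have hne : (multigenerator D x).Nonempty := hD.1.image _
  have hwn : Tendsto (fun r => ‖w r‖) (𝓝[>] t) (𝓝 ‖w t‖) := hw.norm
  have hwd : Tendsto (fun r => ‖w r - w t‖) (𝓝[>] t) (𝓝 0) := by
    simpa using (hw.sub_const (w t)).norm
  rw [Metric.tendsto_nhds]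
  intro ε hε
  set W := ‖w t‖ + 1 with hW
  have hW0 : 0 < W := by positivity
  have hC0 : 0 ≤ C := by
    obtain ⟨l, hl⟩ := hne
    exact (Finset.sum_nonneg fun _ _ => abs_nonneg _).trans (hC l hl)
  -- Near `t`, `‖w r‖ < W`, so kernels within this distance have pairings with `w r` that differ by
  -- at most `ε / 3`; replacing `w r` by `w t` costs another `ε / 3`.
  have hδ : 0 < ε / (3 * W) := by positivity
  filter_upwards [hH.eventually (gt_mem_nhds (ENNReal.ofReal_pos.2 hδ)),
    hwn.eventually (gt_mem_nhds (by linarith : ‖w t‖ < W)),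
    hwd.eventually (gt_mem_nhds (by positivity : 0 < ε / (3 * (C + 1)))),
    Ioo_mem_nhdsGT ht.2] with r hr1 hr2 hr3 hr4
  have hrt : 0 < r - t := sub_pos.2 hr4.1
  have hQ : 𝒳.Q t r ∈ stochasticKernels X := fun x => 𝒳.Q_mem t r ht.1 hr4.1.le hr4.2.le x
  have hs : |supportFn (multigenerator D x) (w r) - supportFn (multigenerator D x) (w t)| ≤
      ε / 3 := by
    refine (abs_supportFn_sub_le hne hC _ _).trans ?_
    calc C * ‖w r - w t‖ ≤ (C + 1) * (ε / (3 * (C + 1))) := by gcongr; linarith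
      _ = ε / 3 := by field_simp
  have hclose : ∀ K M : X → X → ℝ, kernelNorm (K - M) < ε / (3 * W) →
      ∑ y, K x y * w r y ≤ ∑ y, M x y * w r y + ε / 3 := by
    intro K M h
    have h1 := (le_abs_self _).trans (abs_sum_mul_le ((K - M) x) (w r))
    have h2 := sum_abs_le_kernelNorm (K - M) x
    have h3 : (∑ y, |(K - M) x y|) * ‖w r‖ ≤ ε / (3 * W) * W := by gcongr; linarith
    have h4 : ε / (3 * W) * W = ε / 3 := by field_simp
    simp only [Pi.sub_apply, sub_mul, Finset.sum_sub_distrib] at h1 h3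
    linarith
  have hquot : ∀ M : X → X → ℝ, ∑ y, ((r - t)⁻¹ • (M - idKernel X)) x y * w r y =
      (r - t)⁻¹ * (∑ y, w r y * M x y - w r x) := by
    intro M
    have h1 : ∑ y, idKernel X x y * w r y = w r x := by simp [idKernel]
    rw [mul_sub, ← h1, Finset.mul_sum, Finset.mul_sum, ← Finset.sum_sub_distrib]
    refine Finset.sum_congr rfl fun y _ => ?_
    simp only [Pi.smul_apply, Pi.sub_apply, smul_eq_mul]
    ring
  have hup : (r - t)⁻¹ * (σ t x (𝒳.Q t r x) (w r) - w r x) ≤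
      supportFn (multigenerator D x) (w r) + ε / 3 := by
    -- The upper bound needs a kernel that attains the risk; the lower bound uses only that members
    -- of the dual set stay below it.
    obtain ⟨M, hM, hMv⟩ := hσ.exists_mem_multikernel ⟨ht.1, ht.2.le⟩ hQ (w r)
    obtain ⟨N, hN, hMN⟩ := exists_kernelNorm_lt_of_distToSet_lt hδ
      ((distToSet_le_hausdorff_left (mem_image_of_mem _ hM)).trans_lt hr1)
    have h1 := hclose _ _ hMN
    rw [hquot, hMv] at h1
    exact h1.trans (add_le_add_left (sum_mul_le_supportFn hC (mem_image_of_mem _ hN) _) _)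
  have hlow : supportFn (multigenerator D x) (w r) ≤
      (r - t)⁻¹ * (σ t x (𝒳.Q t r x) (w r) - w r x) + ε / 3 := by
    refine supportFn_le hne ?_
    rintro _ ⟨N, hN, rfl⟩
    obtain ⟨_, ⟨M, hM, rfl⟩, hMN⟩ := exists_kernelNorm_lt_of_distToSet_lt hδ
      ((distToSet_le_hausdorff_right hN).trans_lt hr1)
    have h1 := hclose _ _ hMN
    rw [hquot] at h1
    refine h1.trans (add_le_add_left (mul_le_mul_of_nonneg_left ?_ (inv_nonneg.2 hrt.le)) _)
    exact sub_le_sub_right ((hM.2 x).2 (w r)) _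
  rw [Real.dist_eq, abs_lt]
  rw [abs_le] at hs
  constructor <;> linarith [hs.1, hs.2]

end

section

/-! ### Absolutely continuous functions -/

/-- Grönwall's inequality in integral form, backward in time. -/
theorem nonpos_of_le_integral {T C : ℝ} {m : ℝ → ℝ} (hC : 0 ≤ C)
    (hm : ContinuousOn m (Icc 0 T)) (h : ∀ t ∈ Icc 0 T, m t ≤ C * ∫ s in t..T, m s) :
    ∀ t ∈ Icc 0 T, m t ≤ 0 := by
  intro t ht
  have hint : ∀ {a b}, a ∈ Icc 0 T → b ∈ Icc 0 T → IntervalIntegrable m volume a b :=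
    fun ha hb => (hm.mono (uIcc_subset_Icc ha hb)).intervalIntegrable
  have hTT : T ∈ Icc 0 T := ⟨ht.1.trans ht.2, le_rfl⟩
  have h0T : (0 : ℝ) ∈ Icc 0 T := ⟨le_rfl, ht.1.trans ht.2⟩
  set I : ℝ → ℝ := fun t => ∫ s in t..T, m s with hI
  have hIc : ContinuousOn I (Icc 0 T) := by
    have h1 := intervalIntegral.continuousOn_primitive_interval_left (μ := volume)
      (f := m) (a := 0) (b := T) ((hm.mono (uIcc_subset_Icc h0T hTT)).integrableOn_compact
        isCompact_uIcc)
    rwa [uIcc_of_le h0T.2] at h1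
  have hId : ∀ s ∈ Ioo 0 T, HasDerivAt I (-m s) s := fun s hs =>
    intervalIntegral.integral_hasDerivAt_left (hint (Ioo_subset_Icc_self hs) hTT)
      (ContinuousOn.stronglyMeasurableAtFilter isOpen_Ioo (hm.mono Ioo_subset_Icc_self) s hs)
      ((hm s (Ioo_subset_Icc_self hs)).continuousAt (Icc_mem_nhds hs.1 hs.2))
  -- The derivative is `exp(C s) (C I(s) - m(s)) ≥ 0`. Since `I` vanishes at `T`, this forces `I ≤
  -- 0`.
  have hmono : MonotoneOn (fun s => Real.exp (C * s) * I s) (Icc 0 T) := by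
    refine monotoneOn_of_hasDerivWithinAt_nonneg (convex_Icc 0 T)
      ((by fun_prop : Continuous fun s => Real.exp (C * s)).continuousOn.mul hIc)
      (f' := fun s => Real.exp (C * s) * (C * 1) * I s + Real.exp (C * s) * -m s)
      (fun s hs => ?_) fun s hs => ?_
    · rw [interior_Icc] at hs
      exact ((((hasDerivAt_id s).const_mul C).exp).mul (hId s hs)).hasDerivWithinAt
    · rw [interior_Icc] at hs
      have h1 := h s (Ioo_subset_Icc_self hs)
      have h2 := mul_le_mul_of_nonneg_left h1 (Real.exp_pos (C * s)).le
      simp only [hI]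
      linarith
  have h1 := hmono ht hTT ht.2
  simp only [hI, intervalIntegral.integral_same, mul_zero] at h1
  have h2 : ∫ s in t..T, m s ≤ 0 := by
    by_contra! h3
    exact absurd h1 (not_le.2 (mul_pos (Real.exp_pos _) h3))
  exact (h t ht).trans (mul_nonpos_of_nonneg_of_nonpos hC h2)

/-- For a continuous function a bound on the right derivative at every point suffices; a bound
almost everywhere would not. -/
theorem lipschitzOnWith_of_right_deriv_bound {T : ℝ} {φ φ' : ℝ → ℝ} {K : NNReal}
    (hφ : ContinuousOn φ (Icc 0 T))
    (hφ' : ∀ t ∈ Ico 0 T, HasDerivWithinAt φ (φ' t) (Ici t) t)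
    (hK : ∀ t ∈ Ico 0 T, |φ' t| ≤ K) : LipschitzOnWith K φ (Icc 0 T) := by
  have h : ∀ a b, 0 ≤ a → a ≤ b → b ≤ T → |φ b - φ a| ≤ K * (b - a) := fun a b ha hab hb =>
    norm_image_sub_le_of_norm_deriv_right_le_segment (hφ.mono (Icc_subset_Icc ha hb))
      (fun s hs => hφ' s ⟨ha.trans hs.1, hs.2.trans_le hb⟩)
      (fun s hs => hK s ⟨ha.trans hs.1, hs.2.trans_le hb⟩) b ⟨hab, le_rfl⟩
  refine LipschitzOnWith.of_dist_le_mul fun a ha b hb => ?_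
  rw [Real.dist_eq, Real.dist_eq]
  rcases le_total a b with hab | hab
  · rw [abs_sub_comm, abs_sub_comm a b, abs_of_nonneg (sub_nonneg.2 hab)]
    exact h a b ha.1 hab hb.2
  · rw [abs_of_nonneg (sub_nonneg.2 hab)]
    exact h b a hb.1 hab ha.2

theorem EssBddRate.intervalIntegrable {X : Type*} {T : ℝ} (hT : 0 ≤ T)
    {c : ℝ → X → ℝ} (hc : EssBddRate 0 T c) (x : X) :
    IntervalIntegrable (fun s => c s x) volume 0 T := by
  rw [intervalIntegrable_iff_integrableOn_Icc_of_le hT]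
  exact (hc x).integrable le_top

variable {X : Type*} [Fintype X]

/-! ### Uniqueness -/

/-- The running cost cancels in the difference of two solutions, and the support functions are
Lipschitz with a common constant, so the sup norm of the difference satisfies the hypothesis of
Grönwall's inequality. -/
theorem IsBackwardSolution.eqOn {T : ℝ} {c : ℝ → X → ℝ} {f : X → ℝ}
    {𝔊 : ℝ → X → Set (X → ℝ)} {u v : ℝ → X → ℝ} (hne : ∀ t ∈ Ico 0 T, ∀ x, (𝔊 t x).Nonempty)
    {C : ℝ} (hC : ∀ t ∈ Ico 0 T, ∀ x, ∀ l ∈ 𝔊 t x, ∑ y, |l y| ≤ C)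
    (hu : IsBackwardSolution T c f 𝔊 u) (hv : IsBackwardSolution T c f 𝔊 v) :
    ∀ t ∈ Icc 0 T, ∀ x, u t x = v t x := by
  intro t ht x
  have hT : 0 ≤ T := ht.1.trans ht.2
  have hAC : ∀ x, AbsolutelyContinuousOnInterval (fun t => u t x - v t x) 0 T := fun x =>
    (hu.absCont x).fun_sub (hv.absCont x)
  have hcont : ContinuousOn (fun t => ‖u t - v t‖) (Icc 0 T) := by
    refine ContinuousOn.norm (continuousOn_pi.2 fun x => ?_)
    have h := (hAC x).continuousOn
    rwa [uIcc_of_le hT] at h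
  have hderiv : ∀ x, ∀ᵐ s ∂(volume.restrict (Icc 0 T)),
      |deriv (fun t => u t x - v t x) s| ≤ |C| * ‖u s - v s‖ := fun x => by
    have hneT : ∀ᵐ s ∂(volume.restrict (Icc 0 T)), s ≠ T :=
      ae_restrict_of_ae (by simp [ae_iff, measure_singleton])
    filter_upwards [hu.equation x, hv.equation x, hneT, ae_restrict_mem measurableSet_Icc]
      with s h1 h2 h3 h4
    have hs : s ∈ Ico 0 T := ⟨h4.1, lt_of_le_of_ne h4.2 h3⟩
    rw [(h1.fun_sub h2).deriv]
    have h5 := abs_supportFn_sub_le (hne s hs x) (hC s hs x) (v s) (u s)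
    rw [norm_sub_rev] at h5
    have h6 : -c s x - supportFn (𝔊 s x) (u s) - (-c s x - supportFn (𝔊 s x) (v s)) =
        supportFn (𝔊 s x) (v s) - supportFn (𝔊 s x) (u s) := by ring
    rw [h6]
    exact h5.trans (mul_le_mul_of_nonneg_right (le_abs_self C) (norm_nonneg _))
  have hle : ∀ t ∈ Icc 0 T, ‖u t - v t‖ ≤ |C| * ∫ s in t..T, ‖u s - v s‖ := by
    intro t ht
    have hsub : uIcc t T ⊆ Icc 0 T := uIcc_subset_Icc ht ⟨hT, le_rfl⟩
    have hnonneg : 0 ≤ |C| * ∫ s in t..T, ‖u s - v s‖ := mul_nonneg (abs_nonneg _)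
      (intervalIntegral.integral_nonneg ht.2 fun _ _ => norm_nonneg _)
    refine (pi_norm_le_iff_of_nonneg hnonneg).2 fun x => ?_
    -- Absolute continuity recovers the difference from its almost-everywhere derivative; the
    -- terminal values cancel.
    have h1 := ((hAC x).mono (by rwa [uIcc_of_le hT])).integral_deriv_eq_sub (a := t) (b := T)
    simp only [hu.terminal, hv.terminal, sub_self, zero_sub] at h1
    rw [Pi.sub_apply, ← norm_neg, ← h1, ← intervalIntegral.integral_const_mul]
    refine intervalIntegral.norm_integral_le_of_norm_le ht.2 ?_
      ((hcont.mono hsub).intervalIntegrable.const_mul _)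
    rw [← ae_restrict_iff' measurableSet_Ioc]
    exact ae_restrict_of_ae_restrict_of_subset
      (Ioc_subset_Icc_self.trans (Icc_subset_Icc_left ht.1)) (hderiv x)
  have h := nonpos_of_le_integral (abs_nonneg C) hcont hle t ht
  exact congrFun (sub_eq_zero.1 (norm_le_zero_iff.1 h)) x

/-! ### The risk value function -/

section Value

variable [DecidableEq X] {T : ℝ} {𝒳 : Chain X T} {ϱ : ℝ → (Traj X → ℝ) → Traj X → ℝ}
  {σ : ℝ → X → (X → ℝ) → (X → ℝ) → ℝ} {𝔇 : ℝ → Set (X → X → ℝ)} {c : ℝ → X → ℝ}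

/-- The value function with the running cost added is differentiable from the right everywhere. -/
theorem hasDerivWithinAt_value_add_integral (hcons : StronglyTimeConsistent 𝒳 ϱ)
    (hcoh : IsCoherent T ϱ) (hmarkov : IsMarkovian T ϱ) (hlip : LipschitzInLp 𝒳 ϱ)
    (hσ : IsTransitionRiskMapping 𝒳 ϱ σ) (hσcoh : IsCoherentMapping T σ)
    (h𝔇 : ∀ t ∈ Ico 0 T, IsSemiDerivative (multikernel (σ t)) (𝒳.G t) (𝔇 t))
    (hbdd : ∃ C : ℝ, ∀ t ∈ Ico 0 T, ∀ x, ∀ l ∈ multigenerator (𝔇 t) x, ∑ y, |l y| ≤ C)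
    (hc : EssBddRate 0 T c) (f : X → ℝ) (x : X) {t : ℝ} (ht : t ∈ Ico 0 T) :
    HasDerivWithinAt (fun r => value T ϱ c f r x + ∫ s in 0..r, c s x)
      (-supportFn (multigenerator (𝔇 t) x) (value T ϱ c f t)) (Ioi t) t := by
  obtain ⟨C, hC⟩ := hbdd
  have hT : 0 ≤ T := ht.1.trans ht.2.le
  have hint := hc.intervalIntegrable hT x
  have hcont : Tendsto (value T ϱ c f) (𝓝[>] t) (𝓝 (value T ϱ c f t)) := by
    refine tendsto_pi_nhds.2 fun y => ?_
    have h := (continuousOn_value_and_tendsto_slope hcons hcoh hmarkov hlip hc f y).1 t (Ico_subset_Icc_self ht)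
    refine h.tendsto.mono_left (nhdsWithin_le_of_mem ?_)
    exact mem_of_superset (Ioo_mem_nhdsGT ht.2) fun r hr => ⟨ht.1.trans hr.1.le, hr.2.le⟩
  have h1 := tendsto_transitionRisk_slope hσcoh ht (h𝔇 t ht) (hC t ht x) hcont
  have h2 := (continuousOn_value_and_tendsto_slope hcons hcoh hmarkov hlip hc f x).2 t ht
  rw [hasDerivWithinAt_iff_tendsto_slope' self_notMem_Ioi]
  -- The risk of `v_r(X_r)` cancels in the sum, which leaves the negative of the slope of `v + ∫ c`.
  have h3 := (h2.add h1).neg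
  rw [zero_add] at h3
  refine h3.congr' ?_
  filter_upwards [Ioo_mem_nhdsGT ht.2] with r hr
  have h4 : ϱ t (fun ω => value T ϱ c f r (ω r)) (Traj.const x) =
      σ t x (𝒳.Q t r x) (value T ϱ c f r) :=
    hσ t (Ico_subset_Icc_self ht) r ⟨hr.1.le, hr.2.le⟩ c f hc (Traj.const x)
  have h5 : (∫ s in 0..r, c s x) = (∫ s in 0..t, c s x) + ∫ s in t..r, c s x :=
    (intervalIntegral.integral_add_adjacent_intervals
      (hint.mono_set (by rw [uIcc_of_le ht.1, uIcc_of_le hT]; exact Icc_subset_Icc_right ht.2.le))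
      (hint.mono_set (by
        rw [uIcc_of_le hr.1.le, uIcc_of_le hT]; exact Icc_subset_Icc ht.1 hr.2.le))).symm
  rw [slope_def_field, h4, h5, div_eq_inv_mul]
  ring

/-- Adding the integral of `c` removes the running cost from the right derivative, which then exists
and is bounded at every `t < T`, even where `c` is irregular. -/
theorem lipschitzOnWith_value_add_integral (hcons : StronglyTimeConsistent 𝒳 ϱ)
    (hcoh : IsCoherent T ϱ) (hmarkov : IsMarkovian T ϱ) (hlip : LipschitzInLp 𝒳 ϱ)
    (hσ : IsTransitionRiskMapping 𝒳 ϱ σ) (hσcoh : IsCoherentMapping T σ)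
    (h𝔇 : ∀ t ∈ Ico 0 T, IsSemiDerivative (multikernel (σ t)) (𝒳.G t) (𝔇 t))
    (hbdd : ∃ C : ℝ, ∀ t ∈ Ico 0 T, ∀ x, ∀ l ∈ multigenerator (𝔇 t) x, ∑ y, |l y| ≤ C)
    (hT : 0 ≤ T) (hc : EssBddRate 0 T c) (f : X → ℝ) (x : X) :
    ∃ K, LipschitzOnWith K (fun r => value T ϱ c f r x + ∫ s in 0..r, c s x) (Icc 0 T) := by
  obtain ⟨C, hC⟩ := hbdd
  obtain ⟨V, hV0, hV⟩ := hcoh.value_bounded hc f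
  refine ⟨⟨|C| * V, by positivity⟩, lipschitzOnWith_of_right_deriv_bound ?_
    (fun t ht => (hasDerivWithinAt_value_add_integral hcons hcoh hmarkov hlip hσ hσcoh h𝔇 ⟨C, hC⟩
      hc f x ht).Ici_of_Ioi) fun t ht => ?_⟩
  · refine (continuousOn_value_and_tendsto_slope hcons hcoh hmarkov hlip hc f x).1.add ?_
    have h := (hc.intervalIntegrable hT x).absolutelyContinuousOnInterval_intervalIntegral
      (c := 0) (by simp) |>.continuousOn
    rwa [uIcc_of_le hT] at h
  · rw [abs_neg]
    refine (abs_supportFn_le ((h𝔇 t ht).1.image _) (hC t ht x) _).trans ?_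
    refine mul_le_mul (le_abs_self C) ?_ (norm_nonneg _) (abs_nonneg _)
    exact (pi_norm_le_iff_of_nonneg hV0).2 fun y => hV t (Ico_subset_Icc_self ht) y

/-- The value is a Lipschitz function minus the primitive of an integrable one. Almost everywhere
both are differentiable, the first by Lipschitz continuity and the second by Lebesgue's theorem. -/
theorem isBackwardSolution_value (hcons : StronglyTimeConsistent 𝒳 ϱ)
    (hcoh : IsCoherent T ϱ) (hmarkov : IsMarkovian T ϱ) (hlip : LipschitzInLp 𝒳 ϱ)
    (hσ : IsTransitionRiskMapping 𝒳 ϱ σ) (hσcoh : IsCoherentMapping T σ)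
    (h𝔇 : ∀ t ∈ Ico 0 T, IsSemiDerivative (multikernel (σ t)) (𝒳.G t) (𝔇 t))
    (hbdd : ∃ C : ℝ, ∀ t ∈ Ico 0 T, ∀ x, ∀ l ∈ multigenerator (𝔇 t) x, ∑ y, |l y| ≤ C)
    (hT : 0 ≤ T) (hc : EssBddRate 0 T c) (f : X → ℝ) :
    IsBackwardSolution T c f (fun t => multigenerator (𝔇 t)) (value T ϱ c f) := by
  have hlipφ := lipschitzOnWith_value_add_integral hcons hcoh hmarkov hlip hσ hσcoh h𝔇 hbdd hT hc f
  refine ⟨fun x => ?_, fun x => ?_, hcoh.value_terminal hT c f⟩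
  · obtain ⟨K, hK⟩ := hlipφ x
    rw [← uIcc_of_le hT] at hK
    have h := hK.absolutelyContinuousOnInterval.fun_sub
      ((hc.intervalIntegrable hT x).absolutelyContinuousOnInterval_intervalIntegral
        (c := 0) (by simp))
    simpa using h
  · obtain ⟨K, hK⟩ := hlipφ x
    have h0 : ∀ᵐ s : ℝ, s ≠ 0 := by simp [ae_iff, measure_singleton]
    have h1 : ∀ᵐ s : ℝ, s ≠ T := by simp [ae_iff, measure_singleton]
    filter_upwards [ae_restrict_of_ae h0, ae_restrict_of_ae h1,
      ae_restrict_mem measurableSet_Icc,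
      ae_restrict_of_ae (hc.intervalIntegrable hT x).ae_hasDerivAt_integral,
      hK.ae_differentiableWithinAt_real measurableSet_Icc] with t ht0 htT ht hI hd
    have htI : t ∈ Ioo 0 T := ⟨lt_of_le_of_ne ht.1 ht0.symm, lt_of_le_of_ne ht.2 htT⟩
    have h2 := (hd.differentiableAt (Icc_mem_nhds htI.1 htI.2)).hasDerivAt
    have h3 := hasDerivWithinAt_value_add_integral hcons hcoh hmarkov hlip hσ hσcoh h𝔇 hbdd hc f x
      ⟨ht.1, htI.2⟩
    -- Where the two-sided derivative exists, it must be the right derivative already computed.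
    have h4 := (uniqueDiffWithinAt_Ioi t).eq_deriv _ h2.hasDerivWithinAt h3
    rw [h4] at h2
    have h5 := h2.fun_sub (hI (by rwa [uIcc_of_le hT]) 0 (by simp))
    simp only [add_sub_cancel_right] at h5
    exact h5.congr_deriv (by ring)

theorem hasDerivWithinAt_value (hcons : StronglyTimeConsistent 𝒳 ϱ)
    (hcoh : IsCoherent T ϱ) (hmarkov : IsMarkovian T ϱ) (hlip : LipschitzInLp 𝒳 ϱ)
    (hσ : IsTransitionRiskMapping 𝒳 ϱ σ) (hσcoh : IsCoherentMapping T σ)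
    (h𝔇 : ∀ t ∈ Ico 0 T, IsSemiDerivative (multikernel (σ t)) (𝒳.G t) (𝔇 t))
    (hbdd : ∃ C : ℝ, ∀ t ∈ Ico 0 T, ∀ x, ∀ l ∈ multigenerator (𝔇 t) x, ∑ y, |l y| ≤ C)
    (hc : EssBddRate 0 T c) (f : X → ℝ) (x : X) {t : ℝ} (ht : t ∈ Ico 0 T)
    (hlim : Tendsto (fun r => (r - t)⁻¹ * ∫ s in t..r, c s x) (𝓝[>] t) (𝓝 (c t x))) :
    HasDerivWithinAt (fun s => value T ϱ c f s x)
      (-c t x - supportFn (multigenerator (𝔇 t) x) (value T ϱ c f t)) (Ioi t) t := by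
  have hT : 0 ≤ T := ht.1.trans ht.2.le
  have hint := hc.intervalIntegrable hT x
  have h1 := hasDerivWithinAt_value_add_integral hcons hcoh hmarkov hlip hσ hσcoh h𝔇 hbdd hc f x ht
  -- The hypothesis on the averages of `c` is precisely right differentiability of its primitive at
  -- `t`.
  have h2 : HasDerivWithinAt (fun r => ∫ s in 0..r, c s x) (c t x) (Ioi t) t := by
    rw [hasDerivWithinAt_iff_tendsto_slope' self_notMem_Ioi]
    refine hlim.congr' ?_
    filter_upwards [Ioo_mem_nhdsGT ht.2] with r hr
    rw [slope_def_field, div_eq_inv_mul, intervalIntegral.integral_interval_sub_left]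
    · exact hint.mono_set (by
        rw [uIcc_of_le (ht.1.trans hr.1.le), uIcc_of_le hT]; exact Icc_subset_Icc_right hr.2.le)
    · exact hint.mono_set (by
        rw [uIcc_of_le ht.1, uIcc_of_le hT]; exact Icc_subset_Icc_right ht.2.le)
  have h3 := h1.fun_sub h2
  simp only [add_sub_cancel_right] at h3
  exact h3.congr_deriv (by ring)

end Value

end

end CTMCRisk

theorem theorem8p3 {X : Type*} [Fintype X] [DecidableEq X] {T : ℝ} (hT : 0 < T)
    (𝒳 : Chain X T) (ϱ : ℝ → (Traj X → ℝ) → Traj X → ℝ)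
    (hϱ : IsDynamicRiskMeasure T ϱ)
    (hcons : StronglyTimeConsistent 𝒳 ϱ)
    (hcoh : IsCoherent T ϱ)
    (hmarkov : IsMarkovian T ϱ)
    (hlip : LipschitzInLp 𝒳 ϱ)
    (σ : ℝ → X → (X → ℝ) → (X → ℝ) → ℝ)
    (hσ : IsTransitionRiskMapping 𝒳 ϱ σ)
    (hσcoh : IsCoherentMapping T σ)
    (𝔇 : ℝ → Set (X → X → ℝ))
    (h𝔇 : ∀ t ∈ Ico 0 T, IsSemiDerivative (multikernel (σ t)) (𝒳.G t) (𝔇 t))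
    (hmeas : ∀ x, ∀ U : Set (X → ℝ), IsOpen U →
      NullMeasurableSet {t | t ∈ Ico 0 T ∧ (multigenerator (𝔇 t) x ∩ U).Nonempty} volume)
    (hbdd : ∃ C : ℝ, ∀ t ∈ Ico 0 T, ∀ x, ∀ l ∈ multigenerator (𝔇 t) x, ∑ y, |l y| ≤ C)
    (c : ℝ → X → ℝ) (hc : EssBddRate 0 T c) (f : X → ℝ) :
    IsBackwardSolution T c f (fun t => multigenerator (𝔇 t)) (value T ϱ c f) ∧
    (∀ u : ℝ → X → ℝ, IsBackwardSolution T c f (fun t => multigenerator (𝔇 t)) u →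
      ∀ t ∈ Icc 0 T, ∀ x, u t x = value T ϱ c f t x) ∧
    (∀ t ∈ Ico 0 T, ∀ x,
      Tendsto (fun r => (r - t)⁻¹ * ∫ s in t..r, c s x) (𝓝[>] t) (𝓝 (c t x)) →
      HasDerivWithinAt (fun s => value T ϱ c f s x)
        (-c t x - supportFn (multigenerator (𝔇 t) x) (value T ϱ c f t)) (Ioi t) t) := by
  have h := isBackwardSolution_value hcons hcoh hmarkov hlip hσ hσcoh h𝔇 hbdd hT.le hc f
  refine ⟨h, fun u hu => ?_, fun t ht x hlim => hasDerivWithinAt_value hcons hcoh hmarkov hlip hσ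
    hσcoh h𝔇 hbdd hc f x ht hlim⟩
  obtain ⟨C, hC⟩ := hbdd
  exact hu.eqOn (fun t ht x => (h𝔇 t ht).1.image _) hC h
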